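/- Let $n\ge 1$, let $W=S_{n+1}$ be the Weyl group of type $A_n$, acting by permutation of coordinates, and let $S=\{s_1,\dots,s_n\}$, $s_i=(i\ \,i+1)$, be its set of simple reflections. For a dominant weight $\lambda=(\lambda_1\ge\lambda_2\ge\cdots\ge\lambda_{n+1})$ let $P_\lambda=\mathrm{Conv}(W\cdot\lambda)$, and say that $\lambda$ is of type $J\subseteq S$ if $J=\{s\in S : s(\lambda)=\lambda\}$. The projective toric variety $X(J)$ is the one associated with the normal fan of $P_\lambda$ for $\lambda$ of type $J$; the $h$-polynomial of $X(J)$ is $h(t)=\sum_{i=0}^{d} f_i\,(t-1)^i$, where $d=\dim P_\lambda$ and $f_i$ is the number of $i$-dimensional faces of $P_\lambda$. The set $J$ is called combinatorially smooth if $P_\lambda$ is a simple polytope, i.e. each vertex of $P_\lambda$ lies on exactly $d$ edges. (These notions do not depend on the choice of $\lambda$ of type $J$.) For $m\ge 0$ let $E_m(t)=\sum_{i\ge 0}E(m,i)\,t^i$ be the $m$-th Eulerian polynomial, where $E(m,i)$ is the number of permutations $(p_1,\dots,p_m)\in S_m$ with exactly $i$ ascents, that is, exactly $i$ indices $1\le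 j<m$ with $p_j<p_{j+1}$; in particular $E_0=1$. For $0\le k\le n$ let $J(k,n)=\{s_{n-k+1},s_{n-k+2},\dots,s_n\}$ (so $J(0,n)=\emptyset$), and let $h_k(t)$ be the $h$-polynomial of $X(J(k,n))$. Then for every $1\le k\le n$ the set $J(k,n)$ is combinatorially smooth, and $$h_k(t)=h_{k-1}(t)-\binom{n+1}{k+1}\,\bigl(t^k+t^{k-1}+\cdots+t\bigr)\,E_{n-k}(t).$$ -/

import Mathlib

open Polynomial

namespace OrbitPolytope

section Polytopes

variable (𝕜 : Type*) [Field 𝕜] [LinearOrder 𝕜] [IsStrictOrderedRing 𝕜]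
variable {E : Type*} [AddCommGroup E] [Module 𝕜 E]

/-- `F` is a nonempty face of `P`: the set of points of `P` at which some linear functional attains
its maximum over `P`. The functional `0` shows that a nonempty `P` is a face of itself. -/
def IsFace (P F : Set E) : Prop :=
  F.Nonempty ∧ ∃ l : E →ₗ[𝕜] 𝕜, F = {x ∈ P | ∀ y ∈ P, l y ≤ l x}

/-- The (affine) dimension of a nonempty set: the dimension of its direction space. -/
noncomputable def dim (F : Set E) : ℕ := Module.finrank 𝕜 (vectorSpan 𝕜 F)

/-- The number `f_i` of `i`-dimensional faces of `P`. -/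
noncomputable def faceNumber (P : Set E) (i : ℕ) : ℕ :=
  {F : Set E | IsFace 𝕜 P F ∧ dim 𝕜 F = i}.ncard

/-- The `h`-polynomial `h(t) = f(t - 1) = ∑_{i=0}^d f_i (t - 1)^i` of a `d`-dimensional
polytope. -/
noncomputable def hPoly (P : Set E) : ℤ[X] :=
  ∑ i ∈ Finset.range (dim 𝕜 P + 1), C (faceNumber 𝕜 P i : ℤ) * (X - 1) ^ i

/-- A `d`-dimensional polytope is simple if each of its vertices lies on exactly `d` edges. -/
def IsSimple (P : Set E) : Prop :=
  ∀ v : E, IsFace 𝕜 P {v} →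
    {F : Set E | IsFace 𝕜 P F ∧ dim 𝕜 F = 1 ∧ v ∈ F}.ncard = dim 𝕜 P

end Polytopes

section TypeA

/-- The simple reflection `s_{i+1} = (i+1, i+2)` of the Weyl group `S_{n+1}` of type `A_n`
(`Fin n` and `Fin (n + 1)` count from `0`). -/
def simpleReflection (n : ℕ) (i : Fin n) : Equiv.Perm (Fin (n + 1)) :=
  Equiv.swap i.castSucc i.succ

/-- The set `S = {s_1, …, s_n}` of simple reflections. -/
def simpleReflections (n : ℕ) : Set (Equiv.Perm (Fin (n + 1))) :=
  Set.range (simpleReflection n)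

/-- `J(k,n) = {s_{n-k+1}, …, s_n}`; the index of `simpleReflection n i` is `i + 1`, and
`n - k + 1 ≤ i + 1` is written without subtraction. -/
def terminalReflections (k n : ℕ) : Set (Equiv.Perm (Fin (n + 1))) :=
  {s | ∃ i : Fin n, n + 1 ≤ ((i : ℕ) + 1) + k ∧ s = simpleReflection n i}

variable {𝕜 : Type*} [Field 𝕜] [LinearOrder 𝕜] [IsStrictOrderedRing 𝕜]

/-- The action of `S_{n+1}` on `𝕜^{n+1}` by permutation of the coordinates:
`(w x)_{w j} = x_j`. -/
def weylAct {n : ℕ} (w : Equiv.Perm (Fin (n + 1))) (x : Fin (n + 1) → 𝕜) : Fin (n + 1) → 𝕜 :=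
  fun j => x (w⁻¹ j)

/-- The orbit polytope `P_lam = Conv(W · lam)`. -/
def orbitPolytope {n : ℕ} (lam : Fin (n + 1) → 𝕜) : Set (Fin (n + 1) → 𝕜) :=
  convexHull 𝕜 (Set.range fun w : Equiv.Perm (Fin (n + 1)) => weylAct w lam)

/-- `lam` is a dominant weight with `{s ∈ S | s lam = lam} = J`. Dominance means that all
coordinates decrease weakly. The coordinate sum of `lam` is arbitrary: subtracting its mean moves
`lam` into the span of the roots and translates the orbit polytope. -/
def IsDominantOfType {n : ℕ} (J : Set (Equiv.Perm (Fin (n + 1)))) (lam : Fin (n + 1) → 𝕜) : Prop :=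
  Antitone lam ∧ {s ∈ simpleReflections n | weylAct s lam = lam} = J

/-- Every set of simple reflections is the type of a dominant weight: take the sum of the
fundamental weights that belong to the other simple reflections. -/
theorem exists_isDominantOfType {n : ℕ} (J : Set (Equiv.Perm (Fin (n + 1))))
    (hJ : J ⊆ simpleReflections n) : ∃ lam : Fin (n + 1) → 𝕜, IsDominantOfType J lam := by
  classical
  let f : Fin (n + 1) → Fin n → 𝕜 := fun j i =>
    if simpleReflection n i ∉ J ∧ j ≤ i.castSucc then 1 else 0
  have key : ∀ i : Fin n, (∑ a, f i.castSucc a) - ∑ a, f i.succ a =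
      if simpleReflection n i ∉ J then 1 else 0 := by
    intro i
    rw [← Finset.sum_sub_distrib, Finset.sum_eq_single i]
    · have h1 : ¬ i.succ ≤ i.castSucc := by simp [Fin.le_def]
      simp [f, h1]
    · intro a _ ha
      have : i.castSucc ≤ a.castSucc ↔ i.succ ≤ a.castSucc := by
        have : (a : ℕ) ≠ i := fun h => ha (Fin.ext h)
        simp only [Fin.le_def, Fin.val_castSucc, Fin.val_succ]
        omega
      simp [f, this]
    · simp
  refine ⟨fun j => ∑ i, f j i, ?_, ?_⟩
  · intro a b hab
    refine Finset.sum_le_sum fun i _ => ?_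
    by_cases h : simpleReflection n i ∉ J ∧ b ≤ i.castSucc
    · simp [f, h.1, h.2, hab.trans h.2]
    · simp only [f, if_neg h]
      split_ifs <;> simp
  · ext s
    constructor
    · rintro ⟨⟨i, rfl⟩, h⟩
      have h2 := congrFun h i.castSucc
      simp only [weylAct, simpleReflection, Equiv.swap_inv, Equiv.swap_apply_left] at h2
      have h3 := key i
      rw [h2, sub_self] at h3
      by_contra hc
      rw [if_pos hc] at h3
      exact zero_ne_one h3
    · intro hs
      obtain ⟨i, rfl⟩ := hJ hs
      refine ⟨⟨i, rfl⟩, ?_⟩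
      have h3 := key i
      rw [if_neg (not_not.2 hs), sub_eq_zero] at h3
      funext j
      simp only [weylAct, simpleReflection, Equiv.swap_inv]
      by_cases h4 : j = i.castSucc
      · subst h4
        rw [Equiv.swap_apply_left]
        exact h3.symm
      · by_cases h5 : j = i.succ
        · subst h5
          rw [Equiv.swap_apply_right]
          exact h3
        · rw [Equiv.swap_apply_of_ne_of_ne h4 h5]

variable (𝕜) in
/-- `J` is combinatorially smooth: the orbit polytopes of type `J` are simple. -/
def CombinatoriallySmooth {n : ℕ} (J : Set (Equiv.Perm (Fin (n + 1)))) : Prop :=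
  ∀ lam : Fin (n + 1) → 𝕜, IsDominantOfType J lam → IsSimple 𝕜 (orbitPolytope lam)

end TypeA

section Eulerian

/-- The ascent set `{i | p_i < p_{i+1}}` of a permutation `(p_1, …, p_m)`. -/
def ascents {m : ℕ} (σ : Equiv.Perm (Fin m)) : Set (Fin m) :=
  {i | ∃ h : (i : ℕ) + 1 < m, σ i < σ ⟨(i : ℕ) + 1, h⟩}

/-- The Eulerian number `E(m,i)`: the number of permutations in `S_m` with exactly `i` ascents. -/
noncomputable def eulerianNumber (m i : ℕ) : ℕ :=
  {σ : Equiv.Perm (Fin m) | (ascents σ).ncard = i}.ncard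

/-- The `m`-th Eulerian polynomial `E_m(t) = ∑_i E(m,i) t^i`. For `m ≥ 1` the term `i = m` vanishes;
it gives `E_0 = 1`. -/
noncomputable def eulerianPoly (m : ℕ) : ℤ[X] :=
  ∑ i ∈ Finset.range (m + 1), C (eulerianNumber m i : ℤ) * X ^ i

end Eulerian

end OrbitPolytope

/-! Put m = n - k. A weight of type `J(k,n)` decreases strictly on the positions 0, …, m and is
constant from m on (`IsTruncated`). By the rearrangement inequality, the orbit points at which a
functional is maximal depend only on the order of its coefficients, and only up to position m. Hence
faces correspond to ordered set partitions of the coordinates in which all blocks starting at m or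
later are merged. A ranking encodes one by sending each coordinate to the start of its block, capped
at m (`isFace_orbitPolytope_iff`, `rankFace_injOn`). On a face, a block starting before m moves in
all directions of coordinate sum zero and the coordinates of rank m are fixed. This gives the
dimension `rankDim`, and h is `rankSum` at x = t - 1.

Recursion (`rankSum_succ`): capping at m sends rankings of level m + 1 to rankings of level m and
forgets only the block B that starts exactly at m. If more than m elements precede the last part, B
is empty and the term is unchanged. If exactly m do, B is any nonempty subset of the other k + 1
elements, and the weights x^(|B|-1) add up to 1 + t + ⋯ + t^k; the 1 reproduces the old term. So
h_{k-1} - h_k is t + ⋯ + t^k times the sum over rankings with exactly m elements of rank below m.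
These are an m-subset with an ordered set partition of it (`sum_rankings_card_eq`). Writing each
block increasingly turns an ordered partition into a permutation with a chosen subset T of its
ascents, and the sum of x^|T| is t^asc, whence E_m (`rankSum_fin`).

Simplicity: by symmetry take the dominant vertex. Faces through it satisfy ρ j ≤ j and their
dimension counts the j with ρ j < min m j. An edge has one such j, which determines it and can be
any of the n nonzero positions (if m > 0; otherwise the polytope is a point). -/

namespace OrbitPolytope

/-! ### Ordered set partitions encoded by capped ranks -/

section Rankings

open Finset

variable {V : Type*} [Fintype V]

/-- The number of elements strictly below `j` in the preorder defined by `c`, truncated at `m`. -/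
def truncRank {α : Type*} [LinearOrder α] (m : ℕ) (c : V → α) (j : V) : ℕ :=
  min m #{u | c u < c j}

theorem card_filter_lt_lt_iff {α : Type*} [LinearOrder α] (c : V → α) (u j : V) :
    #{w | c w < c u} < #{w | c w < c j} ↔ c u < c j := by
  constructor
  · intro h
    by_contra hc
    refine absurd h (not_lt.2 (card_le_card fun w hw => ?_))
    simp only [mem_filter, mem_univ, true_and] at hw ⊢
    exact hw.trans_le (not_lt.1 hc)
  · intro h
    refine card_lt_card ⟨fun w hw => ?_, fun hs => ?_⟩
    · simp only [mem_filter, mem_univ, true_and] at hw ⊢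
      exact hw.trans h
    · have := hs (mem_filter.2 ⟨mem_univ u, h⟩)
      simp at this

theorem truncRank_truncRank {α : Type*} [LinearOrder α] (m : ℕ) (c : V → α) :
    truncRank m (truncRank m c) = truncRank m c := by
  funext j
  by_cases hj : #{u | c u < c j} ≤ m
  · unfold truncRank
    congr 2
    ext u
    have := card_filter_lt_lt_iff c u j
    simp only [mem_filter, mem_univ, true_and, ← this]
    omega
  · push Not at hj
    -- Among the elements with at least m below them take a lowest one, `v`. Everything below `v`
    -- has uncapped rank less than m, so at least m elements stay strictly below `j` after capping.
    have hS : (univ.filter fun u => m ≤ #{w | c w < c u}).Nonempty := ⟨j, by simp [hj.le]⟩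
    obtain ⟨v, hv, hmin⟩ := exists_min_image _ (fun u => #{w | c w < c u}) hS
    simp only [mem_filter, mem_univ, true_and] at hv hmin
    have h1 : truncRank m c j = m := by simp [truncRank, hj.le]
    have h2 : #{w | c w < c v} ≤ #{u | truncRank m c u < truncRank m c j} := by
      refine card_le_card fun u hu => ?_
      simp only [mem_filter, mem_univ, true_and] at hu ⊢
      have h3 := (card_filter_lt_lt_iff c u v).2 hu
      rw [h1]
      by_contra h4
      have : m ≤ #{w | c w < c u} := by
        unfold truncRank at h4
        omega
      exact absurd (hmin u this) (not_le.2 h3)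
    rw [h1]
    exact min_eq_left (hv.trans h2)

/-- The functions `V → {0, …, m}` that are their own truncated ranks: they encode the ordered set
partitions of `V` up to refinement of the part that starts at a position `≥ m`. -/
def rankings (V : Type*) [Fintype V] [DecidableEq V] (m : ℕ) : Finset (V → ℕ) :=
  {ρ ∈ Fintype.piFinset fun _ => range (m + 1) | truncRank m ρ = ρ}

variable [DecidableEq V]

theorem mem_rankings {m : ℕ} {ρ : V → ℕ} : ρ ∈ rankings V m ↔ truncRank m ρ = ρ := by
  simp only [rankings, mem_filter, Fintype.mem_piFinset, mem_range, and_iff_right_iff_imp]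
  intro h j
  rw [← h, truncRank]
  omega

theorem truncRank_mem_rankings {α : Type*} [LinearOrder α] (m : ℕ) (c : V → α) :
    truncRank m c ∈ rankings V m :=
  mem_rankings.2 (truncRank_truncRank m c)

theorem eq_min_card_of_mem_rankings {m : ℕ} {ρ : V → ℕ} (h : ρ ∈ rankings V m) (j : V) :
    ρ j = min m #{u | ρ u < ρ j} :=
  (congrFun (mem_rankings.1 h) j).symm

theorem le_of_mem_rankings {m : ℕ} {ρ : V → ℕ} (h : ρ ∈ rankings V m) (j : V) : ρ j ≤ m := by
  rw [eq_min_card_of_mem_rankings h j]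
  omega

theorem card_lt_of_mem_rankings {m : ℕ} {ρ : V → ℕ} (h : ρ ∈ rankings V m) {j : V}
    (hj : ρ j < m) : #{u | ρ u < ρ j} = ρ j := by
  have := eq_min_card_of_mem_rankings h j
  omega

/-- The number of elements of rank less than `m`, minus the number of their ranks. -/
def rankDim (m : ℕ) (ρ : V → ℕ) : ℕ :=
  #{j | ρ j < m} - #(image ρ {j | ρ j < m})

/-- The generating polynomial of `rankDim` on `rankings V m`, at `x`. -/
def rankSum (V : Type*) [Fintype V] [DecidableEq V] (m : ℕ) {R : Type*} [CommRing R] (x : R) : R :=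
  ∑ ρ ∈ rankings V m, x ^ rankDim m ρ

end Rankings

/-! ### Ordered set partitions and Eulerian polynomials -/

section Eulerian

open Finset

/-- The first element of the block of `i`, where `i` and `i + 1` share a block if `i ∈ T`. -/
def blockStart (T : Finset ℕ) : ℕ → ℕ
  | 0 => 0
  | i + 1 => if i ∈ T then blockStart T i else i + 1

variable (T : Finset ℕ)

theorem blockStart_le (i : ℕ) : blockStart T i ≤ i := by
  induction i with
  | zero => simp [blockStart]
  | succ i ih =>
    rw [blockStart]
    split_ifs <;> omega

theorem blockStart_succ_eq_iff (i : ℕ) : blockStart T i = blockStart T (i + 1) ↔ i ∈ T := by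
  have := blockStart_le T i
  rw [blockStart]
  split_ifs with h <;> simp only [h, iff_false]; omega

theorem blockStart_mono : Monotone (blockStart T) := by
  refine monotone_nat_of_le_succ fun i => ?_
  have := blockStart_le T i
  rw [blockStart]
  split_ifs <;> omega

theorem blockStart_blockStart (i : ℕ) : blockStart T (blockStart T i) = blockStart T i := by
  induction i with
  | zero => simp [blockStart]
  | succ i ih =>
    by_cases h : i ∈ T
    · rw [← (blockStart_succ_eq_iff T i).2 h, ih]
    · have : blockStart T (i + 1) = i + 1 := by rw [blockStart, if_neg h]
      rw [this, this]

theorem blockStart_lt_blockStart_iff (u i : ℕ) :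
    blockStart T u < blockStart T i ↔ u < blockStart T i := by
  refine ⟨fun h => ?_, (blockStart_le T u).trans_lt⟩
  by_contra hc
  have := blockStart_mono T (not_lt.1 hc)
  rw [blockStart_blockStart] at this
  omega

theorem card_filter_val_lt {m p : ℕ} (h : p ≤ m) : #{u : Fin m | (u : ℕ) < p} = p := by
  rw [Fin.card_filter_val_lt, min_eq_right h]

theorem blockStart_mem_rankings (m : ℕ) :
    (fun i : Fin m => blockStart T i) ∈ rankings (Fin m) m := by
  rw [mem_rankings]
  funext i
  have h := blockStart_le T i
  have h2 := i.2
  simp only [truncRank, blockStart_lt_blockStart_iff]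
  rw [card_filter_val_lt (by omega)]
  omega

/-- The positions that do not start a block are exactly the successors of the elements of `T`. -/
theorem rankDim_blockStart {m : ℕ} (hT : ∀ i ∈ T, i + 1 < m) :
    rankDim m (fun i : Fin m => blockStart T i) = #T := by
  have h1 : (univ.filter fun j : Fin m => blockStart T j < m) = univ := by
    refine filter_true_of_mem fun j _ => (blockStart_le T j).trans_lt j.2
  have h2 : image (fun i : Fin m => blockStart T i) univ =
      {p ∈ range m | blockStart T p = p} := by
    ext p
    simp only [mem_image, mem_univ, true_and, mem_filter, mem_range]
    constructor
    · rintro ⟨i, rfl⟩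
      exact ⟨(blockStart_le T i).trans_lt i.2, blockStart_blockStart T i⟩
    · rintro ⟨h, h'⟩
      exact ⟨⟨p, h⟩, h'⟩
  have h3 : image Nat.succ T = {p ∈ range m | ¬ blockStart T p = p} := by
    ext p
    simp only [mem_image, mem_filter, mem_range]
    cases p with
    | zero => simp [blockStart]
    | succ p =>
      have h4 := blockStart_succ_eq_iff T p
      have h5 := blockStart_le T p
      constructor
      · rintro ⟨i, hi, h⟩
        obtain rfl : i = p := by omega
        refine ⟨hT i hi, ?_⟩
        rw [← h4.2 hi]
        omega
      · rintro ⟨_, h⟩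
        refine ⟨p, ?_, rfl⟩
        by_contra hc
        rw [blockStart, if_neg hc] at h
        exact h rfl
  have h6 := card_filter_add_card_filter_not (s := range m) (fun p => blockStart T p = p)
  rw [← h3, card_image_of_injective _ Nat.succ_injective, card_range] at h6
  rw [rankDim, h1, h2, card_univ, Fintype.card_fin]
  omega

variable {V W : Type*} [Fintype V] [Fintype W] [DecidableEq V]

theorem card_filter_comp_lt {m p : ℕ} (e : W ↪ V) {ρ : V → ℕ} (hρ : ∀ v ∉ Set.range e, m ≤ ρ v)
    (hp : p ≤ m) : #{i | ρ (e i) < p} = #{u | ρ u < p} := by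
  rw [← card_map e]
  congr 1
  ext u
  simp only [mem_map, mem_filter, mem_univ, true_and]
  constructor
  · rintro ⟨i, hi, rfl⟩
    exact hi
  · intro h
    by_cases hu : u ∈ Set.range e
    · obtain ⟨i, rfl⟩ := hu
      exact ⟨i, h, rfl⟩
    · have := hρ u hu
      omega

theorem rankDim_comp {m : ℕ} (e : W ↪ V) {ρ : V → ℕ} (hρ : ∀ v ∉ Set.range e, m ≤ ρ v) :
    rankDim m (ρ ∘ e) = rankDim m ρ := by
  have h : image (ρ ∘ e) {i | (ρ ∘ e) i < m} = image ρ {u | ρ u < m} := by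
    ext p
    simp only [mem_image, mem_filter, mem_univ, true_and, Function.comp]
    constructor
    · rintro ⟨i, hi, rfl⟩
      exact ⟨e i, hi, rfl⟩
    · rintro ⟨u, h, rfl⟩
      by_cases hu : u ∈ Set.range e
      · obtain ⟨i, rfl⟩ := hu
        exact ⟨i, h, rfl⟩
      · have := hρ u hu
        omega
  rw [rankDim, h]
  simp only [Function.comp]
  rw [card_filter_comp_lt e hρ le_rfl, rankDim]

variable [DecidableEq W]

/-- Elements outside the image sit at the cap, so they are never counted below anything; `hm` is
what their own rank m requires. -/
theorem comp_mem_rankings_iff {m : ℕ} (e : W ↪ V) {ρ : V → ℕ} (hρ : ∀ v ∉ Set.range e, ρ v = m)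
    (hm : ∀ v ∉ Set.range e, m ≤ #{u | ρ u < m}) :
    ρ ∘ e ∈ rankings W m ↔ ρ ∈ rankings V m := by
  have hρ' : ∀ v ∉ Set.range e, m ≤ ρ v := fun v hv => (hρ v hv).ge
  constructor
  · intro h
    rw [mem_rankings]
    funext v
    by_cases hv : v ∈ Set.range e
    · obtain ⟨i, rfl⟩ := hv
      have h1 := eq_min_card_of_mem_rankings h i
      have h2 := le_of_mem_rankings h i
      simp only [Function.comp] at h1 h2
      rw [card_filter_comp_lt e hρ' h2] at h1
      exact h1.symm
    · rw [truncRank, hρ v hv]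
      exact min_eq_left (hm v hv)
  · intro h
    rw [mem_rankings]
    funext i
    have h1 := eq_min_card_of_mem_rankings h (e i)
    rw [← card_filter_comp_lt e hρ' (le_of_mem_rankings h (e i))] at h1
    exact h1.symm

theorem comp_equiv_mem_rankings_iff {m : ℕ} (e : W ≃ V) {ρ : V → ℕ} :
    ρ ∘ e ∈ rankings W m ↔ ρ ∈ rankings V m :=
  comp_mem_rankings_iff e.toEmbedding (fun v hv => absurd ⟨e.symm v, by simp⟩ hv)
    (fun v hv => absurd ⟨e.symm v, by simp⟩ hv)

omit [DecidableEq W] in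
theorem rankDim_comp_equiv {m : ℕ} (e : W ≃ V) (ρ : V → ℕ) :
    rankDim m (ρ ∘ e) = rankDim m ρ :=
  rankDim_comp e.toEmbedding (fun v hv => absurd ⟨e.symm v, by simp⟩ hv)

/-- The set of ascents of a permutation, as a finite set of natural numbers. -/
noncomputable def ascentFinset {m : ℕ} (σ : Equiv.Perm (Fin m)) : Finset ℕ := by
  classical exact (ascents σ).toFinset.image (fun i : Fin m => (i : ℕ))

theorem mem_ascentFinset {m : ℕ} {σ : Equiv.Perm (Fin m)} {i : ℕ} :
    i ∈ ascentFinset σ ↔ ∃ h : i + 1 < m, σ ⟨i, by omega⟩ < σ ⟨i + 1, h⟩ := by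
  classical
  rw [ascentFinset, mem_image]
  constructor
  · rintro ⟨j, h, rfl⟩
    have hj : j ∈ ascents σ := Set.mem_toFinset.1 h
    exact hj
  · rintro ⟨h, h'⟩
    have hi : (⟨i, by omega⟩ : Fin m) ∈ ascents σ := ⟨h, h'⟩
    exact ⟨⟨i, by omega⟩, Set.mem_toFinset.2 hi, rfl⟩

theorem card_ascentFinset {m : ℕ} (σ : Equiv.Perm (Fin m)) :
    #(ascentFinset σ) = (ascents σ).ncard := by
  classical
  rw [ascentFinset, card_image_of_injective _ Fin.val_injective, Set.ncard_eq_toFinset_card']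

/-- `Tuple.sort` breaks ties by index, and `σ` increases along each block because all steps inside a
block are ascents. -/
theorem sort_blockStart {m : ℕ} {σ : Equiv.Perm (Fin m)} (hT : T ⊆ ascentFinset σ) :
    Tuple.sort (fun v => blockStart T (σ.symm v)) = σ := by
  symm
  rw [Tuple.eq_sort_iff]
  refine ⟨fun i j hij => ?_, ?_⟩
  · simpa using blockStart_mono T hij
  · have key : ∀ (i : ℕ) (hi : i < m) (d : ℕ) (hd : i + (d + 1) < m),
        blockStart T i = blockStart T (i + (d + 1)) → σ ⟨i, hi⟩ < σ ⟨i + (d + 1), hd⟩ := by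
      intro i hi d
      induction d with
      | zero =>
        intro hd h
        exact (mem_ascentFinset.1 (hT ((blockStart_succ_eq_iff T i).1 h))).2
      | succ d ih =>
        intro hd h
        have h1 := blockStart_mono T (show i ≤ i + (d + 1) by omega)
        have h2 := blockStart_mono T (show i + (d + 1) ≤ i + (d + 1) + 1 by omega)
        have h3 : blockStart T (i + (d + 1) + 1) = blockStart T i := h.symm
        have h4 := (blockStart_succ_eq_iff T (i + (d + 1))).1 (by omega)
        exact (ih (by omega) (by omega)).trans (mem_ascentFinset.1 (hT h4)).2
    intro i j hij h
    simp only [Equiv.symm_apply_apply] at h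
    have hij' : (i : ℕ) < j := hij
    have hj := j.2
    have e1 : (i : ℕ) + ((j - i - 1) + 1) = j := by omega
    have := key i i.2 (j - i - 1) (by omega) (by rw [e1]; exact h)
    simpa only [e1] using this

/-- The positions `i` such that the entries of rank `i` and `i + 1` in the sorted order are tied. -/
def tiedFinset {m : ℕ} (ρ : Fin m → ℕ) : Finset ℕ :=
  {i ∈ range m | ∃ h : i + 1 < m, ∃ h' : i < m,
    ρ (Tuple.sort ρ ⟨i, h'⟩) = ρ (Tuple.sort ρ ⟨i + 1, h⟩)}

theorem mem_tiedFinset {m : ℕ} {ρ : Fin m → ℕ} {i : ℕ} :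
    i ∈ tiedFinset ρ ↔ ∃ h : i + 1 < m,
      ρ (Tuple.sort ρ ⟨i, by omega⟩) = ρ (Tuple.sort ρ ⟨i + 1, h⟩) := by
  simp only [tiedFinset, mem_filter, mem_range]
  constructor
  · rintro ⟨_, h, _, h'⟩
    exact ⟨h, h'⟩
  · rintro ⟨h, h'⟩
    exact ⟨by omega, h, by omega, h'⟩

theorem tiedFinset_subset {m : ℕ} (ρ : Fin m → ℕ) :
    tiedFinset ρ ⊆ ascentFinset (Tuple.sort ρ) := by
  intro i hi
  obtain ⟨h, h'⟩ := mem_tiedFinset.1 hi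
  exact mem_ascentFinset.2 ⟨h, ((Tuple.eq_sort_iff (f := ρ)).1 rfl).2 _ _ (by simp) h'⟩

/-- A ranking is recovered from its sorting permutation and its ties: at a strict jump to sorted
position i + 1, exactly the i + 1 earlier entries are smaller. -/
theorem blockStart_tiedFinset {m : ℕ} {ρ : Fin m → ℕ} (hρ : ρ ∈ rankings (Fin m) m) (i : ℕ)
    (hi : i < m) : blockStart (tiedFinset ρ) i = ρ (Tuple.sort ρ ⟨i, hi⟩) := by
  have hmono : Monotone (ρ ∘ Tuple.sort ρ) := Tuple.monotone_sort ρ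
  have hr : ρ ∘ Tuple.sort ρ ∈ rankings (Fin m) m := (comp_equiv_mem_rankings_iff _).2 hρ
  induction i with
  | zero =>
    have h1 := eq_min_card_of_mem_rankings hr ⟨0, hi⟩
    have h2 : (univ.filter fun u => (ρ ∘ Tuple.sort ρ) u < (ρ ∘ Tuple.sort ρ) ⟨0, hi⟩) = ∅ :=
      filter_false_of_mem fun u _ => not_lt.2 (hmono (Fin.mk_le_of_le_val (Nat.zero_le _)))
    rw [h2] at h1
    simp only [card_empty, Nat.min_zero] at h1
    rw [blockStart]
    exact h1.symm
  | succ i ih =>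
    rw [blockStart]
    split_ifs with h
    · rw [ih (by omega)]
      exact (mem_tiedFinset.1 h).2
    · have hlt : (ρ ∘ Tuple.sort ρ) ⟨i, by omega⟩ < (ρ ∘ Tuple.sort ρ) ⟨i + 1, hi⟩ := by
        refine lt_of_le_of_ne (hmono (by simp)) fun hc => h (mem_tiedFinset.2 ⟨hi, hc⟩)
      have h1 := eq_min_card_of_mem_rankings hr ⟨i + 1, hi⟩
      have h2 : (univ.filter fun u => (ρ ∘ Tuple.sort ρ) u < (ρ ∘ Tuple.sort ρ) ⟨i + 1, hi⟩) =
          univ.filter fun u : Fin m => (u : ℕ) < i + 1 := by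
        refine filter_congr fun u _ => ⟨fun hu => ?_, fun hu => ?_⟩
        · by_contra hc
          exact absurd (hmono (show (⟨i + 1, hi⟩ : Fin m) ≤ u from not_lt.1 hc)) (not_le.2 hu)
        · exact (hmono (show u ≤ (⟨i, by omega⟩ : Fin m) from Nat.lt_succ_iff.1 hu)).trans_lt hlt
      rw [h2, card_filter_val_lt hi.le, min_eq_right hi.le] at h1
      exact h1.symm

/-- Ordered set partitions of an `m`-element set, counted by the number of their blocks, are counted
by the Eulerian polynomial. -/
theorem rankSum_fin (m : ℕ) {R : Type*} [CommRing R] (x : R) :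
    rankSum (Fin m) m x = ∑ σ : Equiv.Perm (Fin m), (x + 1) ^ (ascents σ).ncard := by
  have h1 : ∀ σ : Equiv.Perm (Fin m), (x + 1) ^ (ascents σ).ncard =
      ∑ T ∈ (ascentFinset σ).powerset, x ^ #T := by
    intro σ
    rw [← card_ascentFinset, ← sum_pow_mul_eq_add_pow]
    simp
  simp only [h1]
  rw [sum_sigma', rankSum]
  refine sum_bij' (fun ρ _ => ⟨Tuple.sort ρ, tiedFinset ρ⟩)
    (fun p _ v => blockStart p.2 (p.1.symm v)) ?_ ?_ ?_ ?_ ?_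
  · intro ρ hρ
    simp [tiedFinset_subset]
  · rintro ⟨σ, T⟩ h
    exact (comp_equiv_mem_rankings_iff (V := Fin m) σ.symm).2 (blockStart_mem_rankings T m)
  · intro ρ hρ
    funext v
    have := blockStart_tiedFinset hρ ((Tuple.sort ρ).symm v : Fin m) (Fin.is_lt _)
    simpa using this
  · rintro ⟨σ, T⟩ h
    simp only [mem_sigma, mem_univ, mem_powerset, true_and] at h
    have hs := sort_blockStart T h
    have ht : tiedFinset (fun v => blockStart T (σ.symm v)) = T := by
      ext i
      rw [mem_tiedFinset, hs]
      simp only [Equiv.symm_apply_apply, blockStart_succ_eq_iff, exists_prop,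
        and_iff_right_iff_imp]
      exact fun hi => (mem_ascentFinset.1 (h hi)).1
    simp only [hs, ht]
  · intro ρ hρ
    have h2 : rankDim m (ρ ∘ Tuple.sort ρ) = #(tiedFinset ρ) := by
      rw [← rankDim_blockStart (tiedFinset ρ) (m := m) fun i hi => (mem_tiedFinset.1 hi).1]
      congr 1
      funext i
      exact (blockStart_tiedFinset hρ i i.2).symm
    rw [← h2, rankDim_comp_equiv]

theorem eulerianPoly_eq_sum (m : ℕ) :
    eulerianPoly m = ∑ σ : Equiv.Perm (Fin m), (X : ℤ[X]) ^ (ascents σ).ncard := by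
  classical
  have h : ∀ σ ∈ (univ : Finset (Equiv.Perm (Fin m))), (ascents σ).ncard ∈ range (m + 1) := by
    intro σ _
    have := Set.ncard_le_card (ascents σ)
    simp only [Nat.card_eq_fintype_card, Fintype.card_fin] at this
    exact mem_range.2 (by omega)
  rw [← sum_fiberwise_of_maps_to h, eulerianPoly]
  refine sum_congr rfl fun i _ => ?_
  rw [sum_congr rfl fun σ hσ => by rw [(mem_filter.1 hσ).2], sum_const, eulerianNumber,
    Set.ncard_eq_toFinset_card']
  simp

/-- The rankings with exactly `m` elements of rank less than `m`. -/
theorem sum_rankings_card_eq (m : ℕ) {R : Type*} [CommRing R] (x : R) :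
    ∑ ρ ∈ rankings V m with #{u | ρ u < m} = m, x ^ rankDim m ρ =
      (Fintype.card V).choose m * rankSum (Fin m) m x := by
  have hmaps : ∀ ρ ∈ (rankings V m).filter (fun ρ => #{u | ρ u < m} = m),
      (univ.filter fun u => ρ u < m) ∈ powersetCard m (univ : Finset V) := by
    intro ρ hρ
    exact mem_powersetCard.2 ⟨subset_univ _, (mem_filter.1 hρ).2⟩
  rw [← sum_fiberwise_of_maps_to hmaps, ← card_univ, ← card_powersetCard, ← nsmul_eq_mul]
  refine sum_eq_card_nsmul fun A hA => ?_
  have hAm := (mem_powersetCard.1 hA).2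
  let e : Fin m ≃ A := (A.equivFinOfCardEq hAm).symm
  let f : Fin m ↪ V := e.toEmbedding.trans (Function.Embedding.subtype _)
  have hf : ∀ v, v ∈ Set.range f ↔ v ∈ A := by
    intro v
    constructor
    · rintro ⟨i, rfl⟩
      exact (e i).2
    · intro hv
      exact ⟨e.symm ⟨v, hv⟩, by simp [f]⟩
  have hfA : ∀ i, f i ∈ A := fun i => (e i).2
  have hef : ∀ i, e.symm ⟨f i, hfA i⟩ = i := fun i => by simp [f]
  have hfe : ∀ v (hv : v ∈ A), f (e.symm ⟨v, hv⟩) = v := fun v hv => by simp [f]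
  -- On m elements the cap is never reached, since no element lies below itself.
  have hlt : ∀ ρ ∈ rankings (Fin m) m, ∀ i, ρ i < m := by
    intro ρ hρ i
    rw [eq_min_card_of_mem_rankings hρ i]
    have : #{u | ρ u < ρ i} < #(univ : Finset (Fin m)) :=
      card_lt_card ⟨subset_univ _, fun h => by simpa using h (mem_univ i)⟩
    rw [card_univ, Fintype.card_fin] at this
    omega
  have hout : ∀ ρ ∈ rankings V m, (univ.filter fun u => ρ u < m) = A →
      ∀ v ∉ Set.range f, ρ v = m := by
    intro ρ hρ hρA v hv
    rw [hf, ← hρA] at hv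
    have := le_of_mem_rankings hρ v
    simp only [mem_filter, mem_univ, true_and] at hv
    omega
  rw [rankSum]
  refine sum_bij' (fun ρ _ => ρ ∘ f)
    (fun ρ _ v => if hv : v ∈ A then ρ (e.symm ⟨v, hv⟩) else m) ?_ ?_ ?_ ?_ ?_
  · intro ρ hρ
    simp only [mem_filter] at hρ
    exact (comp_mem_rankings_iff f (hout ρ hρ.1.1 hρ.2) fun v _ => hρ.1.2.ge).2 hρ.1.1
  · intro ρ hρ
    have hA' : (univ.filter fun u => (if hv : u ∈ A then ρ (e.symm ⟨u, hv⟩) else m) < m) = A := by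
      ext v
      simp only [mem_filter, mem_univ, true_and]
      by_cases hv : v ∈ A
      · simp [hv, hlt ρ hρ]
      · simp [hv]
    simp only [mem_filter]
    refine ⟨⟨(comp_mem_rankings_iff f (fun v hv => ?_) fun v _ => ?_).1 ?_, ?_⟩, hA'⟩
    · rw [hf] at hv
      simp [hv]
    · rw [hA', hAm]
    · convert hρ using 1
      funext i
      simp [hfA, hef]
    · rw [hA', hAm]
  · intro ρ hρ
    simp only [mem_filter] at hρ
    funext v
    by_cases hv : v ∈ A
    · simp [hv, hfe]
    · simp only [hv, dif_neg, not_false_eq_true]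
      exact (hout ρ hρ.1.1 hρ.2 v (by rwa [hf])).symm
  · intro ρ hρ
    funext i
    simp [hfA, hef]
  · intro ρ hρ
    simp only [mem_filter] at hρ
    rw [rankDim_comp f fun v hv => (hout ρ hρ.1.1 hρ.2 v hv).ge]

end Eulerian

/-! ### Raising the cap from m to m + 1 -/

section Recursion

open Finset

variable {V : Type*} [DecidableEq V]

/-- This is ((x + 1)^|Z| - 1) / x, written without division. -/
theorem sum_powerset_erase_empty (Z : Finset V) {R : Type*} [CommRing R] (x : R) :
    ∑ B ∈ Z.powerset.erase ∅, x ^ (#B - 1) = ∑ i ∈ range #Z, (x + 1) ^ i := by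
  have h : ∀ Z : Finset V, ∑ B ∈ Z.powerset.erase ∅, x ^ (#B - 1) + 1 =
      ∑ B ∈ Z.powerset, x ^ (#B - 1) := by
    intro Z
    rw [← sum_erase_add _ _ (empty_mem_powerset Z)]
    simp
  -- Truncated subtraction gives `∅` the weight 1; including it lets the induction run over full
  -- powersets.
  rw [← add_left_inj 1, h]
  induction Z using Finset.induction_on with
  | empty => simp
  | insert a Z ha ih =>
    rw [sum_powerset_insert ha, ih, card_insert_of_notMem ha, sum_range_succ]
    have h2 : ∑ B ∈ Z.powerset, x ^ (#(insert a B) - 1) = (x + 1) ^ #Z := by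
      rw [← sum_pow_mul_eq_add_pow]
      refine sum_congr rfl fun B hB => ?_
      rw [card_insert_of_notMem fun hc => ha (mem_powerset.1 hB hc)]
      simp
    rw [h2]
    ring

variable [Fintype V]

/-- The refinement of `ρ` on the elements of rank `m`, where `B` comes first. -/
def refineRank (m : ℕ) (ρ : V → ℕ) (B : Finset V) (j : V) : ℕ :=
  if ρ j < m then ρ j else if j ∈ B then m else m + 1

variable {m : ℕ} {ρ : V → ℕ} {B : Finset V}

/-- Elements of `B` get rank m, below the new cap, so exactly m elements must precede them; the
others are at the cap m + 1 and need only at least that many. -/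
theorem refineRank_mem_rankings_iff (hρ : ρ ∈ rankings V m) (hB : B ⊆ univ.filter fun j => ¬ ρ j < m) :
    refineRank m ρ B ∈ rankings V (m + 1) ↔ (B.Nonempty → #{j | ρ j < m} = m) ∧
      ((∃ j, ¬ ρ j < m ∧ j ∉ B) → m + 1 ≤ #{j | ρ j < m} + #B) := by
  have hB' : ∀ j ∈ B, ¬ ρ j < m := fun j hj => by simpa using hB hj
  have h1 : ∀ p ≤ m, #{u | refineRank m ρ B u < p} = #{u | ρ u < p} := by
    intro p hp
    congr 1
    refine filter_congr fun u _ => ?_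
    unfold refineRank
    split_ifs <;> omega
  have h2 : #{u | refineRank m ρ B u < m + 1} = #{u | ρ u < m} + #B := by
    rw [← card_union_of_disjoint]
    · congr 1
      ext u
      simp only [mem_filter, mem_univ, true_and, mem_union]
      unfold refineRank
      split_ifs <;> simp_all; omega
    · rw [disjoint_left]
      intro u hu hu'
      exact hB' u hu' (by simpa using hu)
  rw [mem_rankings]
  constructor
  · intro h
    refine ⟨fun ⟨j, hj⟩ => ?_, fun ⟨j, hj, hj'⟩ => ?_⟩
    · have h3 := congrFun h j
      have h4 : refineRank m ρ B j = m := by simp [refineRank, hB' j hj, hj]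
      rw [truncRank, h4, h1 m le_rfl] at h3
      omega
    · have h3 := congrFun h j
      have h4 : refineRank m ρ B j = m + 1 := by simp [refineRank, hj, hj']
      rw [truncRank, h4, h2] at h3
      omega
  · rintro ⟨hb, hc⟩
    funext j
    rw [truncRank]
    by_cases hj : ρ j < m
    · have h4 : refineRank m ρ B j = ρ j := by simp [refineRank, hj]
      rw [h4, h1 _ hj.le, card_lt_of_mem_rankings hρ hj]
      omega
    · by_cases hj' : j ∈ B
      · have h4 : refineRank m ρ B j = m := by simp [refineRank, hj, hj']
        rw [h4, h1 m le_rfl, hb ⟨j, hj'⟩]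
        omega
      · have h4 : refineRank m ρ B j = m + 1 := by simp [refineRank, hj, hj']
        rw [h4, h2]
        exact min_eq_left (hc ⟨j, hj, hj'⟩)

theorem rankDim_refineRank_empty :
    rankDim (m + 1) (refineRank m ρ ∅) = rankDim m ρ := by
  have h1 : (univ.filter fun u => refineRank m ρ ∅ u < m + 1) = univ.filter fun u => ρ u < m := by
    refine filter_congr fun u _ => ?_
    simp only [refineRank, notMem_empty, if_false]
    split_ifs <;> omega
  rw [rankDim, h1, rankDim]
  congr 2
  refine image_congr fun u hu => ?_
  simp only [coe_filter, mem_univ, true_and, Set.mem_ofPred_eq] at hu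
  simp [refineRank, hu]

theorem rankDim_refineRank (hB : B ⊆ univ.filter fun j => ¬ ρ j < m) (hne : B.Nonempty) :
    rankDim (m + 1) (refineRank m ρ B) = rankDim m ρ + (#B - 1) := by
  have hB' : ∀ j ∈ B, ¬ ρ j < m := fun j hj => by simpa using hB hj
  have h1 : (univ.filter fun u => refineRank m ρ B u < m + 1) =
      (univ.filter fun u => ρ u < m) ∪ B := by
    ext u
    simp only [mem_filter, mem_univ, true_and, mem_union]
    unfold refineRank
    split_ifs <;> simp_all; omega
  have h2 : Disjoint (univ.filter fun u => ρ u < m) B := by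
    rw [disjoint_left]
    intro u hu hu'
    exact hB' u hu' (by simpa using hu)
  have h3 : image (refineRank m ρ B) ((univ.filter fun u => ρ u < m) ∪ B) =
      insert m (image ρ (univ.filter fun u => ρ u < m)) := by
    rw [image_union, union_comm, insert_eq]
    congr 1
    · ext p
      simp only [mem_image, mem_singleton]
      constructor
      · rintro ⟨j, hj, rfl⟩
        simp [refineRank, hB' j hj, hj]
      · rintro rfl
        obtain ⟨j, hj⟩ := hne
        exact ⟨j, hj, by simp [refineRank, hB' j hj, hj]⟩
    · refine image_congr fun u hu => ?_
      simp only [coe_filter, mem_univ, true_and, Set.mem_ofPred_eq] at hu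
      simp [refineRank, hu]
  have h4 : m ∉ image ρ (univ.filter fun u => ρ u < m) := by
    simp only [mem_image, mem_filter, mem_univ, true_and]
    rintro ⟨u, hu, h⟩
    omega
  have h5 : #(image ρ (univ.filter fun u => ρ u < m)) ≤ #(univ.filter fun u => ρ u < m) :=
    card_image_le
  have h6 := hne.card_pos
  rw [rankDim, h1, h3, card_insert_of_notMem h4, card_union_of_disjoint h2, rankDim]
  omega

/-- A ranking over `ρ` is determined by the set of its elements of rank exactly m. -/
theorem sum_fiber_rankings (hρ : ρ ∈ rankings V m) {R : Type*} [CommRing R] (x : R) :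
    ∑ ρ' ∈ rankings V (m + 1) with (fun j => min m (ρ' j)) = ρ, x ^ rankDim (m + 1) ρ' =
      ∑ B ∈ (univ.filter fun j => ¬ ρ j < m).powerset with
        refineRank m ρ B ∈ rankings V (m + 1), x ^ rankDim (m + 1) (refineRank m ρ B) := by
  have key : ∀ ρ' ∈ rankings V (m + 1), (fun j => min m (ρ' j)) = ρ →
      refineRank m ρ (univ.filter fun j => ρ' j = m) = ρ' := by
    intro ρ' hρ' h
    funext j
    have h1 := congrFun h j
    have h2 := le_of_mem_rankings hρ' j
    simp only [refineRank, mem_filter, mem_univ, true_and]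
    split_ifs <;> omega
  symm
  refine sum_bij' (fun B _ => refineRank m ρ B) (fun ρ' _ => univ.filter fun j => ρ' j = m)
    ?_ ?_ ?_ ?_ ?_
  · intro B hB
    simp only [mem_filter] at hB ⊢
    refine ⟨hB.2, ?_⟩
    funext j
    have := le_of_mem_rankings hρ j
    unfold refineRank
    split_ifs <;> omega
  · intro ρ' hρ'
    simp only [mem_filter] at hρ' ⊢
    refine ⟨mem_powerset.2 fun j hj => ?_, ?_⟩
    · simp only [mem_filter, mem_univ, true_and] at hj ⊢
      have := congrFun hρ'.2 j
      omega
    · rw [key ρ' hρ'.1 hρ'.2]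
      exact hρ'.1
  · intro B hB
    ext j
    simp only [mem_filter, mem_powerset] at hB
    simp only [mem_filter, mem_univ, true_and]
    unfold refineRank
    by_cases hj : j ∈ B
    · have := hB.1 hj
      simp only [mem_filter, mem_univ, true_and] at this
      simp [hj, this]
    · simp only [hj, if_false, iff_false]
      split_ifs <;> omega
  · intro ρ' hρ'
    simp only [mem_filter] at hρ'
    exact key ρ' hρ'.1 hρ'.2
  · intro B _
    rfl

theorem le_card_of_mem_rankings (hρ : ρ ∈ rankings V m) (hm : m ≤ Fintype.card V) :
    m ≤ #{j | ρ j < m} := by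
  by_cases h : ∃ j, ¬ ρ j < m
  · obtain ⟨j, hj⟩ := h
    have h1 := le_of_mem_rankings hρ j
    have h2 := eq_min_card_of_mem_rankings hρ j
    have h3 : ρ j = m := by omega
    rw [h3] at h2
    omega
  · push Not at h
    rw [filter_true_of_mem fun j _ => h j]
    exact hm

theorem rankSum_succ (hm : m < Fintype.card V) {R : Type*} [CommRing R] (x : R) :
    rankSum V (m + 1) x = rankSum V m x +
      (∑ i ∈ Icc 1 (Fintype.card V - m - 1), (x + 1) ^ i) *
        ∑ ρ ∈ rankings V m with #{u | ρ u < m} = m, x ^ rankDim m ρ := by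
  have hmaps : ∀ ρ' ∈ rankings V (m + 1), (fun j => min m (ρ' j)) ∈ rankings V m := by
    intro ρ' hρ'
    convert truncRank_mem_rankings m ρ' using 1
    funext j
    have := eq_min_card_of_mem_rankings hρ' j
    rw [truncRank]
    omega
  rw [rankSum, ← sum_fiberwise_of_maps_to hmaps, rankSum, sum_filter, mul_sum, ← sum_add_distrib]
  refine sum_congr rfl fun ρ hρ => ?_
  rw [sum_fiber_rankings hρ]
  have hle := le_card_of_mem_rankings hρ hm.le
  have hcard : #{u | ρ u < m} + #{u | ¬ ρ u < m} = Fintype.card V := by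
    rw [card_filter_add_card_filter_not, card_univ]
  split_ifs with hq
  · have h1 : ((univ.filter fun j => ¬ ρ j < m).powerset.filter fun B =>
        refineRank m ρ B ∈ rankings V (m + 1)) =
        (univ.filter fun j => ¬ ρ j < m).powerset.erase ∅ := by
      ext B
      simp only [mem_filter, mem_erase, mem_powerset, and_comm (a := B ≠ ∅)]
      refine and_congr_right fun hB => ?_
      rw [refineRank_mem_rankings_iff hρ hB, hq]
      constructor
      · rintro ⟨-, h⟩ rfl
        have hne : (univ.filter fun j => ¬ ρ j < m).Nonempty := card_pos.1 (by omega)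
        obtain ⟨j, hj⟩ := hne
        have := h ⟨j, by simpa using hj, by simp⟩
        simp at this
      · intro h
        have := (nonempty_iff_ne_empty.2 h).card_pos
        exact ⟨fun _ => rfl, fun _ => by omega⟩
    rw [h1]
    have h2 : ∀ B ∈ (univ.filter fun j => ¬ ρ j < m).powerset.erase ∅,
        x ^ rankDim (m + 1) (refineRank m ρ B) = x ^ rankDim m ρ * x ^ (#B - 1) := by
      intro B hB
      simp only [mem_erase, mem_powerset] at hB
      rw [rankDim_refineRank hB.2 (nonempty_iff_ne_empty.2 hB.1), pow_add]
    rw [sum_congr rfl h2, ← mul_sum, sum_powerset_erase_empty]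
    have h3 : #{u | ¬ ρ u < m} = (Fintype.card V - m - 1) + 1 := by omega
    -- The term i = 0 of the geometric sum is the contribution of `ρ` to `rankSum V m x`.
    rw [h3, range_eq_Ico, sum_eq_sum_Ico_succ_bot (Nat.succ_pos _), ← Ico_succ_right_eq_Icc]
    simp only [pow_zero, zero_add, Nat.succ_eq_add_one, Order.succ_eq_add_one]
    ring
  -- Here more than m elements have rank below m, so no block can start exactly at m.
  · have h1 : ((univ.filter fun j => ¬ ρ j < m).powerset.filter fun B =>
        refineRank m ρ B ∈ rankings V (m + 1)) = {∅} := by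
      ext B
      simp only [mem_filter, mem_powerset, mem_singleton]
      constructor
      · rintro ⟨hB, h⟩
        rw [refineRank_mem_rankings_iff hρ hB] at h
        by_contra hc
        exact hq (h.1 (nonempty_iff_ne_empty.2 hc))
      · rintro rfl
        refine ⟨empty_subset _, ?_⟩
        rw [refineRank_mem_rankings_iff hρ (empty_subset _)]
        exact ⟨fun h => absurd h (by simp), fun _ => by omega⟩
    rw [h1, sum_singleton, rankDim_refineRank_empty]
    simp

end Recursion

/-! ### Maximizers on convex hulls; vectors with zero block sums -/

section LinearAlgebra

open Finset

variable {𝕜 : Type*} [Field 𝕜]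

theorem argmax_convexHull [LinearOrder 𝕜] [IsStrictOrderedRing 𝕜] {E : Type*} [AddCommGroup E]
    [Module 𝕜 E] {S : Set E} (l : E →ₗ[𝕜] 𝕜) {M : 𝕜} (hM : ∀ s ∈ S, l s ≤ M)
    (hex : ∃ s ∈ S, l s = M) :
    {x ∈ convexHull 𝕜 S | ∀ y ∈ convexHull 𝕜 S, l y ≤ l x} = convexHull 𝕜 {s ∈ S | l s = M} := by
  obtain ⟨s, hs, hsM⟩ := hex
  -- The right side is convex: a proper convex combination reaches `M` only if both endpoints do.
  have hle : convexHull 𝕜 S ⊆ {x | l x ≤ M ∧ (l x = M → x ∈ convexHull 𝕜 {s ∈ S | l s = M})} := by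
    refine convexHull_min (fun x hx => ⟨hM x hx, fun h => subset_convexHull 𝕜 _ ⟨hx, h⟩⟩) ?_
    rintro x ⟨hx, hx'⟩ y ⟨hy, hy'⟩ a b ha hb hab
    have h1 : l (a • x + b • y) = a * l x + b * l y := by simp
    have h2 : a * M + b * M = M := by rw [← add_mul, hab, one_mul]
    have h3 := mul_le_mul_of_nonneg_left hx ha
    have h4 := mul_le_mul_of_nonneg_left hy hb
    refine ⟨by rw [h1]; linarith, fun h => ?_⟩
    rw [h1] at h
    rcases ha.eq_or_lt with rfl | ha'
    · obtain rfl : b = 1 := by simpa using hab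
      simpa using hy' (by simpa using h)
    rcases hb.eq_or_lt with rfl | hb'
    · obtain rfl : a = 1 := by simpa using hab
      simpa using hx' (by simpa using h)
    · have h5 : a * l x = a * M := by linarith
      have h6 : b * l y = b * M := by linarith
      exact convex_convexHull 𝕜 _ (hx' (mul_left_cancel₀ ha'.ne' h5))
        (hy' (mul_left_cancel₀ hb'.ne' h6)) ha hb hab
  ext x
  constructor
  · rintro ⟨hx, hmax⟩
    have h1 := hmax s (subset_convexHull 𝕜 _ hs)
    exact (hle hx).2 (le_antisymm (hle hx).1 (hsM ▸ h1))
  · intro hx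
    have h1 : convexHull 𝕜 {s ∈ S | l s = M} ⊆ {x | l x = M} := by
      refine convexHull_min (fun x hx => hx.2) ?_
      rintro x hx y hy a b - - hab
      have hx' : l x = M := hx
      have hy' : l y = M := hy
      have : l (a • x + b • y) = M := by
        simp only [map_add, map_smul, hx', hy', smul_eq_mul]
        rw [← add_mul, hab, one_mul]
      exact this
    have h2 : l x = M := h1 hx
    refine ⟨convexHull_mono (fun s hs => hs.1) hx, fun y hy => ?_⟩
    rw [h2]
    exact (hle hy).1

variable {V : Type*} [Fintype V] [DecidableEq V]

variable (𝕜) in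
/-- The sums of the coordinates over the fibers of `π`. -/
def fiberSum (π : V → ℕ) : (V → 𝕜) →ₗ[𝕜] (image π univ → 𝕜) :=
  LinearMap.pi fun p => ∑ j with π j = p, LinearMap.proj j

omit [DecidableEq V] in
theorem mem_ker_fiberSum {π : V → ℕ} {v : V → 𝕜} :
    v ∈ LinearMap.ker (fiberSum 𝕜 π) ↔ ∀ p, ∑ j with π j = p, v j = 0 := by
  rw [LinearMap.mem_ker]
  constructor
  · intro h p
    by_cases hp : p ∈ image π univ
    · have := congrFun h ⟨p, hp⟩
      simpa [fiberSum] using this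
    · rw [filter_false_of_mem, sum_empty]
      rintro j - rfl
      exact hp (mem_image_of_mem _ (mem_univ j))
  · intro h
    funext p
    simpa [fiberSum] using h p

theorem fiberSum_single (π : V → ℕ) (j : V) (a : 𝕜) :
    fiberSum 𝕜 π (Pi.single j a) = Pi.single ⟨π j, mem_image_of_mem _ (mem_univ j)⟩ a := by
  funext p
  obtain ⟨p, hp⟩ := p
  simp only [fiberSum, LinearMap.pi_apply, LinearMap.coe_sum, Finset.sum_apply,
    LinearMap.coe_proj, Function.eval]
  by_cases h : p = π j
  · subst h
    rw [Pi.single_eq_same, sum_eq_single j]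
    · simp
    · intro i _ hij
      simp [hij]
    · simp
  · rw [Pi.single_eq_of_ne (by simpa using h)]
    refine sum_eq_zero fun i hi => ?_
    rw [Pi.single_eq_of_ne]
    rintro rfl
    exact h (mem_filter.1 hi).2.symm

theorem fiberSum_surjective (π : V → ℕ) : Function.Surjective (fiberSum 𝕜 π) := by
  rw [← LinearMap.range_eq_top, eq_top_iff]
  rintro g -
  rw [← Finset.univ_sum_single g]
  refine Submodule.sum_mem _ fun p _ => ?_
  obtain ⟨j, -, hj⟩ := mem_image.1 p.2
  refine ⟨Pi.single j (g p), ?_⟩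
  rw [fiberSum_single]
  congr 1
  exact Subtype.ext hj

theorem finrank_ker_fiberSum (π : V → ℕ) :
    #(image π univ) + Module.finrank 𝕜 (LinearMap.ker (fiberSum 𝕜 π)) = Fintype.card V := by
  have h := LinearMap.finrank_range_add_finrank_ker (fiberSum 𝕜 π)
  rw [LinearMap.range_eq_top.2 (fiberSum_surjective π), finrank_top] at h
  simpa using h

/-- Differences of unit vectors within a fiber span the kernel: subtracting from each unit vector
that of a fiber representative changes `v` by its fiber sums, which vanish. -/
theorem ker_fiberSum_le {π : V → ℕ} {K : Submodule 𝕜 (V → 𝕜)}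
    (h : ∀ u w, u ≠ w → π u = π w → Pi.single u 1 - Pi.single w 1 ∈ K) :
    LinearMap.ker (fiberSum 𝕜 π) ≤ K := by
  intro v hv
  have hs : ∀ p : image π univ, ∃ j, π j = p := fun p => by
    obtain ⟨j, -, hj⟩ := mem_image.1 p.2
    exact ⟨j, hj⟩
  choose s hs using hs
  let r : V → V := fun j => s ⟨π j, mem_image_of_mem _ (mem_univ j)⟩
  have hr : ∀ j, π (r j) = π j := fun j => hs _
  have h1 : ∑ j, v j • (Pi.single (r j) 1 : V → 𝕜) = 0 := by
    rw [← sum_fiberwise_of_maps_to (t := image π univ)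
      fun j _ => mem_image_of_mem π (mem_univ j)]
    refine sum_eq_zero fun p hp => ?_
    have h2 : ∀ j ∈ univ.filter (fun j => π j = p), v j • (Pi.single (r j) 1 : V → 𝕜) =
        v j • Pi.single (s ⟨p, hp⟩) 1 := by
      intro j hj
      have : π j = p := (mem_filter.1 hj).2
      subst this
      rfl
    rw [sum_congr rfl h2, ← sum_smul, mem_ker_fiberSum.1 hv p, zero_smul]
  have h3 : v = ∑ j, v j • ((Pi.single j 1 : V → 𝕜) - Pi.single (r j) 1) := by
    simp only [smul_sub, sum_sub_distrib, h1, sub_zero]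
    exact pi_eq_sum_univ' v |>.trans (sum_congr rfl fun j _ => by
      congr 1)
  rw [h3]
  refine Submodule.sum_mem _ fun j _ => Submodule.smul_mem _ _ ?_
  by_cases hj : j = r j
  · rw [← hj, sub_self]
    exact K.zero_mem
  · exact h _ _ hj (hr j).symm

end LinearAlgebra

/-! ### Faces of the orbit polytope and their dimensions -/

section Faces

open Finset

variable {n m : ℕ}

theorem card_le_of_forall_val_lt {σ : Equiv.Perm (Fin (n + 1))} {A : Finset (Fin (n + 1))} {p : ℕ}
    (h : ∀ u ∈ A, (σ u : ℕ) < p) : #A ≤ p := by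
  have := card_le_card_of_injOn (t := range p) (fun u => (σ u : ℕ))
    (fun u hu => mem_range.2 (h u hu)) fun u _ w _ huw => σ.injective (Fin.ext huw)
  simpa using this

theorem card_add_le_of_forall_le_val {σ : Equiv.Perm (Fin (n + 1))} {A : Finset (Fin (n + 1))}
    {p : ℕ} (hp : p ≤ n + 1) (h : ∀ u ∈ A, p ≤ (σ u : ℕ)) : #A + p ≤ n + 1 := by
  have := card_le_card_of_injOn (t := Ico p (n + 1)) (fun u => (σ u : ℕ))
    (fun u hu => mem_Ico.2 ⟨h u hu, (σ u).2⟩) fun u _ w _ huw => σ.injective (Fin.ext huw)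
  rw [Nat.card_Ico] at this
  omega

theorem exists_perm_card_le {α : Type*} [LinearOrder α] (f : Fin (n + 1) → α) :
    ∃ σ : Equiv.Perm (Fin (n + 1)), ∀ j, #{u | f u < f j} ≤ σ j ∧ σ j < #{u | f u ≤ f j} := by
  have hmono : Monotone (f ∘ Tuple.sort f) := Tuple.monotone_sort f
  refine ⟨(Tuple.sort f).symm, fun j => ⟨?_, ?_⟩⟩
  · refine card_le_of_forall_val_lt (σ := (Tuple.sort f).symm) fun u hu => ?_
    simp only [mem_filter, mem_univ, true_and] at hu
    by_contra hc
    have := hmono (show (Tuple.sort f).symm j ≤ (Tuple.sort f).symm u from not_lt.1 hc)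
    simp only [Function.comp, Equiv.apply_symm_apply] at this
    exact absurd hu (not_lt.2 this)
  · have h1 : #(Iic ((Tuple.sort f).symm j)) ≤ #{u | f u ≤ f j} := by
      refine card_le_card_of_injOn (Tuple.sort f) (fun p hp => ?_)
        (Tuple.sort f).injective.injOn
      have := hmono (mem_Iic.1 hp)
      simpa using this
    rw [Fin.card_Iic] at h1
    omega

/-- There is a permutation compatible with the ranking `ρ` that puts `j` in front of its block. -/
theorem exists_perm_of_mem_rankings {ρ : Fin (n + 1) → ℕ} (hρ : ρ ∈ rankings (Fin (n + 1)) m)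
    (j : Fin (n + 1)) :
    ∃ σ : Equiv.Perm (Fin (n + 1)), (∀ i, ρ i ≤ σ i) ∧ min m (σ j) = ρ j := by
  -- Doubling leaves room to place `j` before the rest of its block without disturbing the order of
  -- the blocks.
  obtain ⟨σ, hσ⟩ := exists_perm_card_le fun u => 2 * ρ u + if u = j then 0 else 1
  have h1 : ∀ i, ρ i ≤ σ i := by
    intro i
    refine le_trans ((eq_min_card_of_mem_rankings hρ i).le.trans (min_le_right _ _)) ?_
    refine le_trans (card_le_card fun u hu => ?_) (hσ i).1
    simp only [mem_filter, mem_univ, true_and] at hu ⊢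
    split_ifs <;> omega
  refine ⟨σ, h1, le_antisymm ?_ (le_min (le_of_mem_rankings hρ j) (h1 j))⟩
  rw [eq_min_card_of_mem_rankings hρ j]
  refine min_le_min_left _ ?_
  have h2 : (univ.filter fun u => 2 * ρ u + (if u = j then 0 else 1) ≤
      2 * ρ j + if j = j then 0 else 1) ⊆ insert j (univ.filter fun u => ρ u < ρ j) := by
    intro u hu
    simp only [mem_filter, mem_univ, true_and, mem_insert, if_true] at hu ⊢
    split_ifs at hu with h
    · exact Or.inl h
    · right
      omega
  have h3 := (card_le_card h2).trans (card_insert_le _ _)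
  have h4 := (hσ j).2
  omega

variable {𝕜 : Type*} [Field 𝕜] [LinearOrder 𝕜] [IsStrictOrderedRing 𝕜]

/-- `lam` decreases strictly on `0, …, m` and is constant from `m` on. -/
def IsTruncated (m : ℕ) (lam : Fin (n + 1) → 𝕜) : Prop :=
  ∀ i j : Fin (n + 1), lam i ≤ lam j ↔ min m (j : ℕ) ≤ min m (i : ℕ)

/-- The face of the orbit polytope of `lam` that is encoded by the ranking `ρ`. -/
def rankFace (lam : Fin (n + 1) → 𝕜) (ρ : Fin (n + 1) → ℕ) : Set (Fin (n + 1) → 𝕜) :=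
  convexHull 𝕜 ((fun σ : Equiv.Perm (Fin (n + 1)) => lam ∘ σ) '' {σ | ∀ j, ρ j ≤ σ j})

variable {lam : Fin (n + 1) → 𝕜} {ρ : Fin (n + 1) → ℕ}

omit [Field 𝕜] [IsStrictOrderedRing 𝕜] in
-- Turns the equality case of the rearrangement inequality into lower bounds on positions, which
-- suffice by counting.
theorem antivary_comp_iff (hlam : IsTruncated m lam) {α : Type*} [LinearOrder α]
    (c : Fin (n + 1) → α) (σ : Equiv.Perm (Fin (n + 1))) :
    Antivary c (lam ∘ σ) ↔ ∀ j, truncRank m c j ≤ σ j := by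
  constructor
  · intro h j
    by_contra hc
    have hj : (σ j : ℕ) < m := by
      unfold truncRank at hc
      omega
    have h1 : #{u | c u < c j} ≤ σ j := by
      refine card_le_of_forall_val_lt (σ := σ) fun u hu => ?_
      simp only [mem_filter, mem_univ, true_and] at hu
      have h2 : lam (σ j) ≤ lam (σ u) := by
        by_contra h3
        exact absurd hu (not_lt.2 (h (not_le.1 h3)))
      rw [hlam] at h2
      have h3 : σ u ≠ σ j := fun h4 => by
        rw [σ.injective h4] at hu
        exact lt_irrefl _ hu
      have h4 : (σ u : ℕ) ≠ σ j := fun h5 => h3 (Fin.ext h5)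
      omega
    unfold truncRank at hc
    omega
  · intro h u j huj
    by_contra hc
    push Not at hc
    have h1 : ¬ min m (σ u : ℕ) ≤ min m (σ j : ℕ) := by
      rw [← hlam]
      exact not_le.2 huj
    have hj := h j
    have h2 : #{w | c w < c j} ≤ σ j := by
      unfold truncRank at hj
      omega
    -- Pigeonhole: with p elements below `j`, the n + 1 - p others together with `u` would all need
    -- positions ≥ p.
    have h3 : ∀ w ∈ insert u (univ.filter fun w => ¬ c w < c j), #{w | c w < c j} ≤ σ w := by
      intro w hw
      rcases mem_insert.1 hw with rfl | hw
      · omega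
      · have h4 : #{v | c v < c j} ≤ #{v | c v < c w} := by
          refine card_le_card fun v hv => ?_
          simp only [mem_filter, mem_univ, true_and] at hv hw ⊢
          exact hv.trans_le (not_lt.1 hw)
        have hw' := h w
        unfold truncRank at hw'
        omega
    have h4 := card_add_le_of_forall_le_val (by omega) h3
    have h5 := card_filter_add_card_filter_not (s := univ) (fun w => c w < c j)
    rw [card_insert_of_notMem (by simpa using hc)] at h4
    rw [card_univ, Fintype.card_fin] at h5
    omega

theorem truncRank_le_of_mem_rankings {α : Type*} [LinearOrder α] (hρ : ρ ∈ rankings _ m)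
    {c : Fin (n + 1) → α} (h : ∀ u w, c u < c w → ρ u < ρ w) (j : Fin (n + 1)) :
    truncRank m c j ≤ ρ j := by
  rw [eq_min_card_of_mem_rankings hρ j]
  refine min_le_min_left _ (card_le_card fun u hu => ?_)
  simp only [mem_filter, mem_univ, true_and] at hu ⊢
  exact h _ _ hu

theorem sum_mul_comp_le (hlam : IsTruncated m lam) {c : Fin (n + 1) → 𝕜}
    {σ : Equiv.Perm (Fin (n + 1))} (hσ : ∀ j, truncRank m c j ≤ σ j)
    (τ : Equiv.Perm (Fin (n + 1))) :
    ∑ j, c j * lam (σ j) ≤ ∑ j, c j * lam (τ j) := by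
  have h := ((antivary_comp_iff hlam c σ).2 hσ).sum_mul_le_sum_mul_comp_perm (σ := τ.trans σ.symm)
  simpa using h

theorem sum_mul_comp_eq_iff (hlam : IsTruncated m lam) {c : Fin (n + 1) → 𝕜}
    {σ : Equiv.Perm (Fin (n + 1))} (hσ : ∀ j, truncRank m c j ≤ σ j)
    (τ : Equiv.Perm (Fin (n + 1))) :
    ∑ j, c j * lam (τ j) = ∑ j, c j * lam (σ j) ↔ ∀ j, truncRank m c j ≤ τ j := by
  rw [← antivary_comp_iff hlam c τ]
  have h := ((antivary_comp_iff hlam c σ).2 hσ).sum_mul_eq_sum_mul_comp_perm_iff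
    (σ := τ.trans σ.symm)
  have h2 : (lam ∘ σ) ∘ (τ.trans σ.symm) = lam ∘ τ := by
    funext j
    simp
  rw [h2] at h
  simpa using h

omit [IsStrictOrderedRing 𝕜] in
theorem orbitPolytope_eq (lam : Fin (n + 1) → 𝕜) :
    orbitPolytope lam =
      convexHull 𝕜 (Set.range fun σ : Equiv.Perm (Fin (n + 1)) => lam ∘ σ) := by
  unfold orbitPolytope
  congr 1
  ext x
  constructor
  · rintro ⟨σ, rfl⟩
    exact ⟨σ⁻¹, rfl⟩
  · rintro ⟨σ, rfl⟩
    exact ⟨σ⁻¹, by funext j; simp [weylAct]⟩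

omit [IsStrictOrderedRing 𝕜] in
theorem orbitPolytope_eq_rankFace (lam : Fin (n + 1) → 𝕜) :
    orbitPolytope lam = rankFace lam 0 := by
  rw [orbitPolytope_eq, rankFace, ← Set.image_univ]
  congr 2
  ext σ
  simp

theorem argmax_eq_rankFace (hlam : IsTruncated m lam) (l : (Fin (n + 1) → 𝕜) →ₗ[𝕜] 𝕜) :
    {x ∈ orbitPolytope lam | ∀ y ∈ orbitPolytope lam, l y ≤ l x} =
      rankFace lam (truncRank m fun j => -l (Pi.single j 1)) := by
  -- With this sign, small `c` belongs to early positions, where `lam` is large.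
  set c : Fin (n + 1) → 𝕜 := fun j => -l (Pi.single j 1) with hc
  have hl : ∀ x, l x = -∑ j, c j * x j := by
    intro x
    conv_lhs => rw [pi_eq_sum_univ' x]
    simp only [map_sum, map_smul, hc, neg_mul, sum_neg_distrib, neg_neg, smul_eq_mul]
    refine sum_congr rfl fun j _ => ?_
    rw [mul_comm]
  obtain ⟨σ, hσ⟩ := exists_perm_card_le c
  have hσ' : ∀ j, truncRank m c j ≤ σ j := fun j => (min_le_right _ _).trans (hσ j).1
  rw [orbitPolytope_eq, argmax_convexHull l (M := l (lam ∘ σ)), rankFace]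
  · congr 1
    ext x
    constructor
    · rintro ⟨⟨τ, rfl⟩, h⟩
      refine ⟨τ, ?_, rfl⟩
      rw [hl, hl, neg_inj] at h
      exact (sum_mul_comp_eq_iff hlam hσ' τ).1 h
    · rintro ⟨τ, hτ, rfl⟩
      refine ⟨⟨τ, rfl⟩, ?_⟩
      rw [hl, hl, neg_inj]
      exact (sum_mul_comp_eq_iff hlam hσ' τ).2 hτ
  · rintro _ ⟨τ, rfl⟩
    rw [hl, hl, neg_le_neg_iff]
    exact sum_mul_comp_le hlam hσ' τ
  · exact ⟨_, ⟨σ, rfl⟩, rfl⟩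

omit [IsStrictOrderedRing 𝕜] in
theorem comp_mem_rankFace {σ : Equiv.Perm (Fin (n + 1))} (h : ∀ j, ρ j ≤ σ j) :
    lam ∘ σ ∈ rankFace lam ρ :=
  subset_convexHull 𝕜 _ ⟨σ, h, rfl⟩

omit [IsStrictOrderedRing 𝕜] in
theorem rankFace_nonempty (hρ : ρ ∈ rankings _ m) : (rankFace lam ρ).Nonempty := by
  obtain ⟨σ, hσ, -⟩ := exists_perm_of_mem_rankings hρ 0
  exact ⟨_, comp_mem_rankFace hσ⟩

theorem isFace_orbitPolytope_iff (hlam : IsTruncated m lam) {F : Set (Fin (n + 1) → 𝕜)} :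
    IsFace 𝕜 (orbitPolytope lam) F ↔ ∃ ρ ∈ rankings (Fin (n + 1)) m, rankFace lam ρ = F := by
  constructor
  · rintro ⟨-, l, rfl⟩
    exact ⟨_, truncRank_mem_rankings m _, (argmax_eq_rankFace hlam l).symm⟩
  · rintro ⟨ρ, hρ, rfl⟩
    refine ⟨rankFace_nonempty hρ, -∑ j, (ρ j : 𝕜) • LinearMap.proj j, ?_⟩
    rw [argmax_eq_rankFace hlam]
    congr 1
    conv_lhs => rw [← mem_rankings.1 hρ]
    funext j
    simp [truncRank, Pi.single_apply]

theorem apply_le_of_mem_rankFace (hlam : IsTruncated m lam) {x : Fin (n + 1) → 𝕜}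
    (hx : x ∈ rankFace lam ρ) {j p : Fin (n + 1)} (hp : min m (p : ℕ) ≤ ρ j) : x j ≤ lam p := by
  have h : rankFace lam ρ ⊆ {x | x j ≤ lam p} := by
    refine convexHull_min ?_ (convex_halfSpace_le (LinearMap.proj j).isLinear _)
    rintro _ ⟨σ, hσ, rfl⟩
    refine (hlam _ _).2 ?_
    have := hσ j
    omega
  exact h hx

/-- The value of `lam` at a position with capped index ρ j bounds coordinate j on the face, so the
face determines its ranking. -/
theorem comp_mem_rankFace_iff (hlam : IsTruncated m lam) (hρ : ρ ∈ rankings _ m)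
    {τ : Equiv.Perm (Fin (n + 1))} : lam ∘ τ ∈ rankFace lam ρ ↔ ∀ j, ρ j ≤ τ j := by
  refine ⟨fun h j => ?_, comp_mem_rankFace⟩
  obtain ⟨σ, -, hj⟩ := exists_perm_of_mem_rankings hρ j
  have h1 := (hlam _ _).1 (apply_le_of_mem_rankFace hlam h hj.le)
  omega

theorem le_of_rankFace_subset (hlam : IsTruncated m lam) {ρ' : Fin (n + 1) → ℕ}
    (hρ : ρ ∈ rankings _ m) (hρ' : ρ' ∈ rankings _ m) (h : rankFace lam ρ' ⊆ rankFace lam ρ) :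
    ρ ≤ ρ' := by
  intro j
  obtain ⟨σ, hσ, hj⟩ := exists_perm_of_mem_rankings hρ' j
  have h1 := (comp_mem_rankFace_iff hlam hρ).1 (h (comp_mem_rankFace hσ)) j
  have h2 := le_of_mem_rankings hρ j
  change ρ j ≤ ρ' j
  omega

theorem rankFace_injOn (hlam : IsTruncated m lam) :
    Set.InjOn (rankFace lam) (rankings (Fin (n + 1)) m : Set (Fin (n + 1) → ℕ)) :=
  fun _ hρ _ hρ' h => le_antisymm (le_of_rankFace_subset hlam hρ hρ' h.ge)
    (le_of_rankFace_subset hlam hρ' hρ h.le)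

/-- The blocks of the ordered set partition of `ρ`, with singletons from rank `m` on. -/
def blockIndex (m : ℕ) (ρ : Fin (n + 1) → ℕ) (j : Fin (n + 1)) : ℕ :=
  if ρ j < m then ρ j else m + j

/-- The indicator of {ρ ≥ p} is weakly compatible with the order of `ρ`, so both permutations
minimize its pairing with the orbit. Subtracting the cases p and p + 1 isolates one block. -/
theorem sum_filter_eq_of_lt (hlam : IsTruncated m lam) (hρ : ρ ∈ rankings _ m)
    {σ τ : Equiv.Perm (Fin (n + 1))} (hσ : ∀ j, ρ j ≤ σ j) (hτ : ∀ j, ρ j ≤ τ j) (p : ℕ) :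
    ∑ j with ρ j = p, lam (σ j) = ∑ j with ρ j = p, lam (τ j) := by
  have key : ∀ p, ∑ j with p ≤ ρ j, lam (σ j) = ∑ j with p ≤ ρ j, lam (τ j) := by
    intro p
    have h1 : ∀ j, truncRank m (fun j => if p ≤ ρ j then (1 : 𝕜) else 0) j ≤ ρ j := by
      refine truncRank_le_of_mem_rankings hρ fun u w huw => ?_
      by_contra hc
      split_ifs at huw
      · exact lt_irrefl _ huw
      · exact absurd huw (by simp)
      · omega
      · exact lt_irrefl _ huw
    have h2 := (sum_mul_comp_eq_iff hlam (fun j => (h1 j).trans (hσ j)) τ).2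
      fun j => (h1 j).trans (hτ j)
    simpa [← sum_filter] using h2.symm
  have hsplit : ∀ f : Fin (n + 1) → 𝕜, ∑ j with p ≤ ρ j, f j =
      ∑ j with ρ j = p, f j + ∑ j with p + 1 ≤ ρ j, f j := by
    intro f
    rw [← sum_union]
    · refine sum_congr ?_ fun _ _ => rfl
      ext j
      simp only [mem_filter, mem_univ, true_and, mem_union]
      omega
    · rw [disjoint_left]
      intro j hj hj'
      simp only [mem_filter, mem_univ, true_and] at hj hj'
      omega
  have h1 := key p
  rw [hsplit, hsplit, key (p + 1)] at h1
  exact add_right_cancel h1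

theorem vectorSpan_rankFace (hlam : IsTruncated m lam) (hρ : ρ ∈ rankings _ m) :
    vectorSpan 𝕜 (rankFace lam ρ) = LinearMap.ker (fiberSum 𝕜 (blockIndex m ρ)) := by
  rw [rankFace, ← direction_affineSpan, affineSpan_convexHull, direction_affineSpan]
  refine le_antisymm ?_ (ker_fiberSum_le fun u w huw h => ?_)
  · rw [vectorSpan_def, Submodule.span_le]
    rintro _ ⟨_, ⟨σ, hσ, rfl⟩, _, ⟨τ, hτ, rfl⟩, rfl⟩
    refine mem_ker_fiberSum.2 fun p => ?_
    simp only [vsub_eq_sub, Pi.sub_apply, Function.comp, sum_sub_distrib, sub_eq_zero]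
    by_cases hp : p < m
    · have h1 : (univ.filter fun j => blockIndex m ρ j = p) = univ.filter fun j => ρ j = p := by
        refine filter_congr fun j _ => ?_
        unfold blockIndex
        split_ifs <;> omega
      rw [h1]
      exact sum_filter_eq_of_lt hlam hρ hσ hτ p
    · refine sum_congr rfl fun j hj => ?_
      have h1 : m ≤ ρ j := by
        have := (mem_filter.1 hj).2
        unfold blockIndex at this
        split_ifs at this <;> omega
      have h2 := hσ j
      have h3 := hτ j
      exact le_antisymm ((hlam _ _).2 (by omega)) ((hlam _ _).2 (by omega))
  · have huw' : (u : ℕ) ≠ w := fun h => huw (Fin.ext h)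
    have h1 : ρ u < m ∧ ρ u = ρ w := by
      unfold blockIndex at h
      split_ifs at h <;> omega
    obtain ⟨σ, hσ, hu⟩ := exists_perm_of_mem_rankings hρ u
    have h2 : ∀ j, ρ j ≤ ((Equiv.swap u w).trans σ) j := by
      intro j
      rw [Equiv.trans_apply]
      by_cases hju : j = u
      · rw [hju, Equiv.swap_apply_left, h1.2]
        exact hσ w
      · by_cases hjw : j = w
        · rw [hjw, Equiv.swap_apply_right, ← h1.2]
          exact hσ u
        · rw [Equiv.swap_apply_of_ne_of_ne hju hjw]
          exact hσ j
    have h3 : (σ w : ℕ) ≠ σ u := fun h => huw' (congrArg Fin.val (σ.injective (Fin.ext h))).symm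
    -- As `u` heads its block, it sits at position ρ u < m and `w` sits later, so the values differ
    -- even if the block runs past m.
    have h4 : lam (σ u) - lam (σ w) ≠ 0 := by
      intro h
      have := (hlam _ _).1 (sub_eq_zero.1 h).le
      have := hσ w
      have := (hlam _ _).1 (sub_eq_zero.1 h).ge
      omega
    have h5 : lam ∘ σ - lam ∘ ((Equiv.swap u w).trans σ) =
        (lam (σ u) - lam (σ w)) • ((Pi.single u 1 : Fin (n + 1) → 𝕜) - Pi.single w 1) := by
      funext j
      simp only [Pi.sub_apply, Function.comp, Equiv.trans_apply, Pi.smul_apply, smul_eq_mul]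
      by_cases hju : j = u
      · subst hju
        simp [huw]
      · by_cases hjw : j = w
        · subst hjw
          simp [hju]
        · simp [Equiv.swap_apply_of_ne_of_ne, hju, hjw]
    rw [← inv_smul_smul₀ h4 ((Pi.single u 1 : Fin (n + 1) → 𝕜) - Pi.single w 1), ← h5]
    exact Submodule.smul_mem _ _ (vsub_mem_vectorSpan 𝕜 ⟨σ, hσ, rfl⟩ ⟨_, h2, rfl⟩)

theorem dim_rankFace (hlam : IsTruncated m lam) (hρ : ρ ∈ rankings _ m) :
    dim 𝕜 (rankFace lam ρ) = rankDim m ρ := by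
  have h1 := finrank_ker_fiberSum (𝕜 := 𝕜) (blockIndex m ρ)
  have h2 : image (blockIndex m ρ) univ = image ρ (univ.filter fun j => ρ j < m) ∪
      image (fun j : Fin (n + 1) => m + j) (univ.filter fun j => ¬ ρ j < m) := by
    conv_lhs => rw [← filter_union_filter_not_eq (fun j => ρ j < m) univ, image_union]
    congr 1
    · refine image_congr fun j hj => ?_
      have : ρ j < m := (mem_filter.1 hj).2
      simp [blockIndex, this]
    · refine image_congr fun j hj => ?_
      have : ¬ ρ j < m := (mem_filter.1 hj).2
      simp [blockIndex, this]
  have h3 : Disjoint (image ρ (univ.filter fun j => ρ j < m))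
      (image (fun j : Fin (n + 1) => m + (j : ℕ)) (univ.filter fun j => ¬ ρ j < m)) := by
    rw [disjoint_left]
    intro p hp hp'
    simp only [mem_image, mem_filter, mem_univ, true_and] at hp hp'
    obtain ⟨i, hi, rfl⟩ := hp
    obtain ⟨j, -, hj⟩ := hp'
    omega
  have h4 := card_filter_add_card_filter_not (s := univ) (fun j => ρ j < m)
  rw [card_univ] at h4
  have h5 := congrArg card h2
  rw [card_union_of_disjoint h3,
    card_image_of_injective _ fun i j h => Fin.ext (Nat.add_left_cancel h)] at h5
  rw [dim, vectorSpan_rankFace hlam hρ, rankDim]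
  omega

theorem zero_mem_rankings : (0 : Fin (n + 1) → ℕ) ∈ rankings (Fin (n + 1)) m := by
  rw [mem_rankings]
  funext j
  simp [truncRank]

theorem setOf_isFace_eq (hlam : IsTruncated m lam) (q : (Fin (n + 1) → ℕ) → Prop)
    [DecidablePred q] (Q : Set (Fin (n + 1) → 𝕜) → Prop)
    (h : ∀ ρ ∈ rankings (Fin (n + 1)) m, Q (rankFace lam ρ) ↔ q ρ) :
    {F | IsFace 𝕜 (orbitPolytope lam) F ∧ Q F}.ncard =
      #{ρ ∈ rankings (Fin (n + 1)) m | q ρ} := by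
  have h1 : {F | IsFace 𝕜 (orbitPolytope lam) F ∧ Q F} =
      rankFace lam '' ((rankings (Fin (n + 1)) m).filter q : Set (Fin (n + 1) → ℕ)) := by
    ext F
    constructor
    · rintro ⟨hF, hQ⟩
      obtain ⟨ρ, hρ, rfl⟩ := (isFace_orbitPolytope_iff hlam).1 hF
      exact ⟨ρ, mem_filter.2 ⟨hρ, (h ρ hρ).1 hQ⟩, rfl⟩
    · rintro ⟨ρ, hρ, rfl⟩
      have hρ' := mem_filter.1 hρ
      exact ⟨(isFace_orbitPolytope_iff hlam).2 ⟨ρ, hρ'.1, rfl⟩, (h ρ hρ'.1).2 hρ'.2⟩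
  rw [h1, ((rankFace_injOn hlam).mono fun ρ hρ => (mem_filter.1 hρ).1).ncard_image,
    Set.ncard_coe_finset]

theorem hPoly_orbitPolytope (hlam : IsTruncated m lam) :
    hPoly 𝕜 (orbitPolytope lam) = rankSum (Fin (n + 1)) m (X - 1 : ℤ[X]) := by
  have hmaps : ∀ ρ ∈ rankings (Fin (n + 1)) m,
      rankDim m ρ ∈ range (dim 𝕜 (orbitPolytope lam) + 1) := by
    intro ρ hρ
    rw [mem_range, Nat.lt_succ_iff, ← dim_rankFace hlam hρ]
    refine Submodule.finrank_mono (vectorSpan_mono 𝕜 ?_)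
    rw [orbitPolytope_eq_rankFace]
    exact convexHull_mono (Set.image_mono fun σ _ j => Nat.zero_le _)
  rw [rankSum, ← sum_fiberwise_of_maps_to hmaps, hPoly]
  refine sum_congr rfl fun i _ => ?_
  rw [sum_congr rfl fun ρ hρ => by rw [(mem_filter.1 hρ).2], sum_const, faceNumber,
    setOf_isFace_eq hlam (fun ρ => rankDim m ρ = i) (fun F => dim 𝕜 F = i)
      fun ρ hρ => by rw [dim_rankFace hlam hρ]]
  simp

end Faces

/-! ### Edges at a vertex -/

section Simplicity

open Finset

variable {n m : ℕ}

/-- If p < m is a rank, exactly p elements have smaller rank; these include 0, …, p - 1, hence are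
these. -/
theorem apply_eq_self_of_le {ρ : Fin (n + 1) → ℕ} (hρ : ρ ∈ rankings (Fin (n + 1)) m)
    (hle : ∀ j, ρ j ≤ j) {p i : Fin (n + 1)} (hp : ρ i = p) (hpm : (p : ℕ) < m) :
    ρ p = p ∧ ∀ j, p ≤ j → (p : ℕ) ≤ ρ j := by
  have h1 : (univ.filter fun u => ρ u < p) = univ.filter fun u : Fin (n + 1) => (u : ℕ) < p := by
    symm
    refine eq_of_subset_of_card_le (fun u hu => ?_) ?_
    · simp only [mem_filter, mem_univ, true_and] at hu ⊢
      exact (hle u).trans_lt hu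
    · have h2 := card_lt_of_mem_rankings hρ (j := i) (by omega)
      rw [hp] at h2
      rw [h2, card_filter_val_lt (by omega)]
  have h3 : ∀ j, p ≤ j → (p : ℕ) ≤ ρ j := by
    intro j hj
    by_contra hc
    have : j ∈ univ.filter fun u => ρ u < p := by simpa using hc
    rw [h1] at this
    simp only [mem_filter, mem_univ, true_and] at this
    exact absurd this (not_lt.2 hj)
  exact ⟨le_antisymm (hle p) (h3 p le_rfl), h3⟩

/-- Each rank below m is attained at the element equal to it, so the ranks cancel against the fixed
points. -/
theorem rankDim_eq_card_of_le {ρ : Fin (n + 1) → ℕ} (hρ : ρ ∈ rankings (Fin (n + 1)) m)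
    (hle : ∀ j, ρ j ≤ j) : rankDim m ρ = #{j | ρ j < min m j} := by
  have h1 : image ρ (univ.filter fun j => ρ j < m) =
      image Fin.val (univ.filter fun j : Fin (n + 1) => ρ j < m ∧ ρ j = j) := by
    ext p
    simp only [mem_image, mem_filter, mem_univ, true_and]
    constructor
    · rintro ⟨i, hi, rfl⟩
      have hi' : ρ i < n + 1 := (hle i).trans_lt i.2
      have := (apply_eq_self_of_le hρ hle (p := ⟨ρ i, hi'⟩) rfl hi).1
      exact ⟨⟨ρ i, hi'⟩, ⟨this.trans_lt hi, this⟩, rfl⟩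
    · rintro ⟨i, ⟨hi, hi'⟩, rfl⟩
      exact ⟨i, hi, hi'⟩
  have h2 : (univ.filter fun j => ρ j < m) =
      (univ.filter fun j : Fin (n + 1) => ρ j < m ∧ ρ j = j) ∪
        univ.filter fun j : Fin (n + 1) => ρ j < min m j := by
    ext j
    have := hle j
    simp only [mem_filter, mem_univ, true_and, mem_union]
    omega
  have h3 : Disjoint (univ.filter fun j : Fin (n + 1) => ρ j < m ∧ ρ j = j)
      (univ.filter fun j : Fin (n + 1) => ρ j < min m j) := by
    rw [disjoint_left]
    intro j hj hj'
    simp only [mem_filter, mem_univ, true_and] at hj hj'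
    omega
  rw [rankDim, h1, card_image_of_injective _ Fin.val_injective, h2, card_union_of_disjoint h3]
  omega

/-- The ranking of the edge at the dominant vertex that joins `t` to the preceding block. -/
def edgeRank (m : ℕ) (t j : Fin (n + 1)) : ℕ :=
  if j = t then min m t - 1 else min m j

theorem edgeRank_le (t j : Fin (n + 1)) : edgeRank m t j ≤ j := by
  unfold edgeRank
  split_ifs with h
  · subst h
    omega
  · omega

theorem card_edgeRank_lt (t : Fin (n + 1)) {p : ℕ} (hp : p ≤ m)
    (hpt : p < t ∧ p < m ∨ (t : ℕ) < p) (hn : p ≤ n + 1) : #{u | edgeRank m t u < p} = p := by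
  refine Eq.trans (congrArg card (filter_congr fun u _ => ?_)) (card_filter_val_lt hn)
  unfold edgeRank
  split_ifs with h
  · subst h
    omega
  · omega

theorem edgeRank_mem_rankings (hm : 0 < m) {t : Fin (n + 1)} (ht : t ≠ 0) :
    edgeRank m t ∈ rankings (Fin (n + 1)) m := by
  have ht' : 0 < (t : ℕ) := Fin.pos_iff_ne_zero.2 ht
  have ht2 := t.2
  rw [mem_rankings]
  funext j
  rw [truncRank]
  have hj := j.2
  by_cases hjt : j = t
  · have h1 : edgeRank m t j = min m t - 1 := by simp [edgeRank, hjt]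
    rw [h1, card_edgeRank_lt t (by omega) (by omega) (by omega)]
    omega
  · have h1 : edgeRank m t j = min m j := by simp [edgeRank, hjt]
    have hjt' : (j : ℕ) ≠ t := fun h => hjt (Fin.ext h)
    rw [h1]
    by_cases h2 : m ≤ t ∧ m ≤ j
    -- Here `t` itself has rank m - 1, so m + 1 elements lie below `j`; the cap absorbs the excess.
    · rw [min_eq_left h2.2]
      refine min_eq_left ?_
      refine (card_filter_val_lt (m := n + 1) (p := m) (by omega)).ge.trans ?_
      refine card_le_card fun u hu => ?_
      simp only [mem_filter, mem_univ, true_and] at hu ⊢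
      exact (edgeRank_le t u).trans_lt hu
    · rw [card_edgeRank_lt t (by omega) (by omega) (by omega)]
      omega

theorem edgeRank_lt_iff (hm : 0 < m) {t : Fin (n + 1)} (ht : t ≠ 0) (j : Fin (n + 1)) :
    edgeRank m t j < min m j ↔ j = t := by
  have ht' : 0 < (t : ℕ) := Fin.pos_iff_ne_zero.2 ht
  unfold edgeRank
  split_ifs with h
  · subst h
    simp only [iff_true]
    omega
  · simp [h]

theorem eq_edgeRank {ρ : Fin (n + 1) → ℕ} (hρ : ρ ∈ rankings (Fin (n + 1)) m)
    (hle : ∀ j, ρ j ≤ j) {t : Fin (n + 1)} (ht : ∀ j, ρ j < min m j ↔ j = t) :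
    ρ = edgeRank m t := by
  have hmin : ∀ j, ρ j ≤ min m j := fun j => le_min (le_of_mem_rankings hρ j) (hle j)
  funext j
  unfold edgeRank
  have hj := ht j
  have hj' := hmin j
  split_ifs with h
  · subst h
    have h1 := hj.2 rfl
    by_contra hc
    -- If the rank of `j` dropped by more than one, this p would keep its rank p and force rank at
    -- least p on `j`.
    let p : Fin (n + 1) := ⟨ρ j + 1, by omega⟩
    have h2 : ρ p = p := by
      have h3 := ht p
      have h4 := hmin p
      have h5 : p ≠ j := fun h => by
        have : ρ j + 1 = j := congrArg Fin.val h
        omega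
      have h6 : (p : ℕ) = ρ j + 1 := rfl
      have h7 := fun h => h5 (h3.1 h)
      omega
    have h3 := (apply_eq_self_of_le hρ hle h2 (show ρ j + 1 < m by omega)).2 j
      (show ρ j + 1 ≤ j by omega)
    have h4 : (p : ℕ) = ρ j + 1 := rfl
    omega
  · have := fun h' => h (hj.1 h')
    omega

theorem card_rankings_rankDim_eq_one :
    #{ρ ∈ rankings (Fin (n + 1)) m | rankDim m ρ = 1 ∧ ∀ j : Fin (n + 1), ρ j ≤ j} =
      if m = 0 then 0 else n := by
  split_ifs with hm
  · subst hm
    rw [card_eq_zero, filter_eq_empty_iff]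
    rintro ρ hρ ⟨h, hle⟩
    rw [rankDim_eq_card_of_le hρ hle] at h
    simp at h
  · have h1 : ((rankings (Fin (n + 1)) m).filter fun ρ => rankDim m ρ = 1 ∧ ∀ j : Fin (n + 1), ρ j ≤ j) =
        image (edgeRank m) (univ.erase 0) := by
      ext ρ
      simp only [mem_filter, mem_image, mem_erase, mem_univ, and_true]
      constructor
      · rintro ⟨hρ, h, hle⟩
        rw [rankDim_eq_card_of_le hρ hle, card_eq_one] at h
        obtain ⟨t, ht⟩ := h
        have ht' : ∀ j, ρ j < min m j ↔ j = t := fun j => by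
          simpa using Finset.ext_iff.1 ht j
        refine ⟨t, ?_, (eq_edgeRank hρ hle ht').symm⟩
        rintro rfl
        have := (ht' 0).2 rfl
        simp at this
      · rintro ⟨t, ht, rfl⟩
        have hρ := edgeRank_mem_rankings (Nat.pos_of_ne_zero hm) ht
        refine ⟨hρ, ?_, edgeRank_le t⟩
        rw [rankDim_eq_card_of_le hρ (edgeRank_le t), card_eq_one]
        refine ⟨t, ?_⟩
        ext j
        simpa using edgeRank_lt_iff (Nat.pos_of_ne_zero hm) ht j
    rw [h1, card_image_of_injOn, card_erase_of_mem (mem_univ _), card_univ, Fintype.card_fin,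
      Nat.add_sub_cancel]
    intro t ht t' ht' h
    have h2 := (edgeRank_lt_iff (Nat.pos_of_ne_zero hm) (mem_erase.1 ht).1 t).2 rfl
    rw [h] at h2
    exact (edgeRank_lt_iff (Nat.pos_of_ne_zero hm) (mem_erase.1 ht').1 t).1 h2

theorem rankDim_zero : rankDim m (0 : Fin (n + 1) → ℕ) = if m = 0 then 0 else n := by
  split_ifs with hm
  · simp [rankDim, hm]
  · have h1 : (univ.filter fun j : Fin (n + 1) => (0 : Fin (n + 1) → ℕ) j < m) = univ :=
      filter_true_of_mem fun j _ => Nat.pos_of_ne_zero hm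
    have h2 : image (0 : Fin (n + 1) → ℕ) univ = {0} := image_const univ_nonempty 0
    rw [rankDim, h1, h2]
    simp

variable {𝕜 : Type*} [Field 𝕜] [LinearOrder 𝕜] [IsStrictOrderedRing 𝕜]

theorem isSimple_orbitPolytope {lam : Fin (n + 1) → 𝕜} (hlam : IsTruncated m lam) :
    IsSimple 𝕜 (orbitPolytope lam) := by
  intro v hv
  obtain ⟨ρ, hρ, hF⟩ := (isFace_orbitPolytope_iff hlam).1 hv
  obtain ⟨τ, hτ, -⟩ := exists_perm_of_mem_rankings hρ 0
  have hτv : lam ∘ τ = v := by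
    have := comp_mem_rankFace (lam := lam) hτ
    rw [hF] at this
    exact this
  subst hτv
  rw [setOf_isFace_eq hlam (fun ρ => rankDim m ρ = 1 ∧ ∀ j, ρ j ≤ τ j)
      (fun F => dim 𝕜 F = 1 ∧ lam ∘ τ ∈ F) fun ρ hρ => by
        rw [dim_rankFace hlam hρ, comp_mem_rankFace_iff hlam hρ],
    orbitPolytope_eq_rankFace, dim_rankFace hlam zero_mem_rankings, rankDim_zero,
    ← card_rankings_rankDim_eq_one]
  -- Relabeling by `τ` moves the vertex to `lam` itself.
  refine card_nbij' (fun ρ => ρ ∘ τ.symm) (fun ρ => ρ ∘ τ) ?_ ?_ ?_ ?_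
  · intro ρ hρ
    have h := mem_filter.1 hρ
    refine mem_filter.2 ⟨(comp_equiv_mem_rankings_iff τ.symm).2 h.1, ?_, fun j => ?_⟩
    · rw [rankDim_comp_equiv]
      exact h.2.1
    · simpa using h.2.2 (τ.symm j)
  · intro ρ hρ
    have h := mem_filter.1 hρ
    refine mem_filter.2 ⟨(comp_equiv_mem_rankings_iff τ).2 h.1, ?_, fun j => h.2.2 (τ j)⟩
    rw [rankDim_comp_equiv]
    exact h.2.1
  · intro ρ _
    funext j
    simp
  · intro ρ _
    funext j
    simp

theorem simpleReflection_injective (n : ℕ) : Function.Injective (simpleReflection n) := by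
  intro i j h
  have h1 := congrArg (fun s : Equiv.Perm (Fin (n + 1)) => s i.castSucc) h
  simp only [simpleReflection, Equiv.swap_apply_left, Equiv.swap_apply_def] at h1
  split_ifs at h1 with h2 h3
  · exact Fin.castSucc_injective _ h2
  · simp only [Fin.ext_iff, Fin.val_castSucc, Fin.val_succ] at h1 h3
    omega
  · simp [Fin.ext_iff] at h1

omit [Field 𝕜] [IsStrictOrderedRing 𝕜] in
theorem isTruncated_of_isDominantOfType {k : ℕ} {lam : Fin (n + 1) → 𝕜}
    (h : IsDominantOfType (terminalReflections k n) lam) : IsTruncated (n - k) lam := by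
  obtain ⟨hanti, hJ⟩ := h
  have hstep : ∀ i : Fin n, lam i.castSucc = lam i.succ ↔ n - k ≤ i := by
    intro i
    have h1 : simpleReflection n i ∈ terminalReflections k n ↔ n - k ≤ i := by
      constructor
      · rintro ⟨j, hj, hij⟩
        rw [simpleReflection_injective n hij]
        omega
      · intro hi
        exact ⟨i, by omega, rfl⟩
    rw [← h1, ← hJ]
    constructor
    · intro hi
      refine ⟨⟨i, rfl⟩, ?_⟩
      funext j
      simp only [weylAct, simpleReflection, Equiv.swap_inv, Equiv.swap_apply_def]
      split_ifs with h2 h3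
      · rw [h2, hi]
      · rw [h3, hi]
      · rfl
    · rintro ⟨-, hi⟩
      have := congrFun hi i.succ
      simpa [weylAct, simpleReflection] using this
  have hconst : ∀ d i : ℕ, n - k ≤ i → ∀ hi : i + d < n + 1,
      lam ⟨i, by omega⟩ = lam ⟨i + d, hi⟩ := by
    intro d i hki
    induction d with
    | zero => intro _; rfl
    | succ d ih =>
      intro hi
      rw [ih (by omega)]
      exact (hstep ⟨i + d, by omega⟩).2 (by simp only; omega)
  have hlt : ∀ i j : Fin (n + 1), i < j → (i : ℕ) < n - k → lam j < lam i := by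
    intro i j hij hi
    have hij' : (i : ℕ) < j := hij
    have hin : (i : ℕ) < n := by omega
    refine lt_of_le_of_lt (hanti (show (⟨i, hin⟩ : Fin n).succ ≤ j from hij')) ?_
    refine lt_of_le_of_ne (hanti (Fin.castSucc_le_succ (⟨i, hin⟩ : Fin n))) fun hc => ?_
    have := (hstep ⟨i, hin⟩).1 hc.symm
    simp only at this
    omega
  intro i j
  constructor
  · intro hij
    by_contra hc
    exact absurd hij (not_le.2 (hlt i j (Fin.lt_def.2 (by omega)) (by omega)))
  · intro hij
    rcases le_or_gt j i with hji | hji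
    · exact hanti hji
    · have hji' : (i : ℕ) < j := hji
      have h1 := hconst (j - i) i (by omega) (by omega)
      have h2 : (⟨i + (j - i), by omega⟩ : Fin (n + 1)) = j := Fin.ext (by simp only; omega)
      rw [h2] at h1
      exact h1.le

end Simplicity

end OrbitPolytope

theorem theorem6 (𝕜 : Type*) [Field 𝕜] [LinearOrder 𝕜] [IsStrictOrderedRing 𝕜]
    (n k : ℕ) (hk : 1 ≤ k) (hkn : k ≤ n) :
    OrbitPolytope.CombinatoriallySmooth 𝕜 (OrbitPolytope.terminalReflections k n) ∧
    ∀ lam mu : Fin (n + 1) → 𝕜,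
      OrbitPolytope.IsDominantOfType (OrbitPolytope.terminalReflections k n) lam →
      OrbitPolytope.IsDominantOfType (OrbitPolytope.terminalReflections (k - 1) n) mu →
      OrbitPolytope.hPoly 𝕜 (OrbitPolytope.orbitPolytope lam) =
        OrbitPolytope.hPoly 𝕜 (OrbitPolytope.orbitPolytope mu) -
          C ((n + 1).choose (k + 1) : ℤ) * (∑ i ∈ Finset.Icc 1 k, X ^ i) *
            OrbitPolytope.eulerianPoly (n - k) := by
  refine ⟨fun lam hlam => OrbitPolytope.isSimple_orbitPolytope
    (OrbitPolytope.isTruncated_of_isDominantOfType hlam), fun lam mu hlam hmu => ?_⟩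
  -- Removing one reflection raises the cap by one, so `rankSum_succ` compares the two polytopes.
  have hm : n - (k - 1) = n - k + 1 := by omega
  have hmu' := OrbitPolytope.isTruncated_of_isDominantOfType hmu
  rw [hm] at hmu'
  have hchoose : (n + 1).choose (n - k) = (n + 1).choose (k + 1) := by
    rw [← Nat.choose_symm (show k + 1 ≤ n + 1 by omega)]
    congr 1
    omega
  have hcard : n + 1 - (n - k) - 1 = k := by omega
  rw [OrbitPolytope.hPoly_orbitPolytope (OrbitPolytope.isTruncated_of_isDominantOfType hlam),
    OrbitPolytope.hPoly_orbitPolytope hmu',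
    OrbitPolytope.rankSum_succ (by rw [Fintype.card_fin]; omega),
    OrbitPolytope.sum_rankings_card_eq, OrbitPolytope.rankSum_fin, sub_add_cancel,
    ← OrbitPolytope.eulerianPoly_eq_sum, Fintype.card_fin, hchoose, hcard]
  simp only [map_natCast]
  ring
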